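/- **Setup.** A seller can produce at most $k\ge 1$ units. The total production cost $f:[0,k]\to\mathbb R$ is convex, non-decreasing and continuous with $f(0)=0$; the marginal costs are $c_i=f(i)-f(i-1)$, $1\le i\le k$, and $c_{k+1}=+\infty$. Buyers arrive one at a time; buyer $t$ offers a price $p_t\in[p_{\min},p_{\max}]$ for one unit, where $c_1<p_{\min}\le p_{\max}$, and must be accepted or rejected immediately and irrevocably, knowing only the prices $p_1,\dots,p_t$; at most $k$ buyers are accepted, and neither later prices nor the number of buyers is known. The profit is the sum of the accepted prices minus $f(\text{number of accepted buyers})$. A (possibly randomized) online algorithm $\mathsf{ALG}$ is $\alpha$-competitive ($\alpha>0$) if $\mathbb E[\mathsf{ALG}(\mathcal I)]\ge \frac1\alpha\mathsf{OPT}(\mathcal I)$ for every finite price sequence $\mathcal I$, where $\mathsf{OPT}(\mathcal I)$ is the maximum profit over all sets of at most $k$ buyers. For $p\in[p_{\min},p_{\max}]$ let $\Gamma(p)$ be the $i\in\{1,\dots,k\}$ with $c_i\le p<c_{i+1}$; put $\underline k=\Gamma(p_{\min})$, $\bar k=\Gamma(p_{\max})$, $n=\bar k-\underline k$, and let $q^{(1)}=p_{\min}$,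 $q^{(\ell)}=c_{\underline k+\ell-1}$ for $2\le \ell\le n+1$, $q^{(n+2)}=p_{\max}$. Let $$F(y)=\frac{p_{\min}\underline k-f(\underline k)}{p_{\min}y-f(y)} .$$ Call $0<\gamma^{(1)}\le\gamma^{(2)}\le\dots\le\gamma^{(n+2)}=\bar k$ with $p_{\min}\gamma^{(1)}>f(\gamma^{(1)})$ a *solution* if, with $\alpha=F(\gamma^{(1)})$, for every $\ell\in\{1,\dots,n+1\}$ $$\frac{q^{(\ell+1)}(\underline k+\ell-1)}{\exp\big(\frac{\alpha}{\underline k+\ell-1}\gamma^{(\ell+1)}\big)}-\frac{q^{(\ell)}(\underline k+\ell-1)}{\exp\big(\frac{\alpha}{\underline k+\ell-1}\gamma^{(\ell)}\big)}=-\int_{\gamma^{(\ell)}}^{\gamma^{(\ell+1)}}\frac{\alpha f'(y)}{\exp\big(\frac{\alpha}{\underline k+\ell-1}y\big)}\,dy .$$ **Theorem 2 (Lower Bound).** For every setup: 1. A solution exists. It is unique if $q^{(n+1)}<p_{\max}$ (that is, unless $p_{\max}=p_{\min}$ or $p_{\max}=c_{\bar k}$ with $\bar k>\underline k$). 2. Every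 solution satisfies $\gamma^{(\ell)}<\gamma^{(\ell+1)}$ whenever $q^{(\ell)}<q^{(\ell+1)}$; in particular it is strictly increasing if the levels $q^{(\ell)}$ are. Moreover $\gamma^{(1)}\in(0,\underline k]$ whenever $F(\gamma^{(1)})\ge 1$. 3. For every solution put $\mathsf{CR}^{\mathsf{lb}}_f(\rho,k)=F(\gamma^{(1)})=\dfrac{p_{\min}\underline k-f(\underline k)}{p_{\min}\gamma^{(1)}-f(\gamma^{(1)})}$, where $\rho=p_{\max}/p_{\min}$. No online algorithm, randomized or not, is $\big(\mathsf{CR}^{\mathsf{lb}}_f(\rho,k)-\epsilon\big)$-competitive for any $\epsilon>0$. -/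

import Mathlib

open MeasureTheory

noncomputable section

namespace OSCC

/-- A setup of online selection with convex costs: a convex, non-decreasing, continuous production
cost `cost` on `[0, k]` with zero start-up cost, a production capacity `k ≥ 1`, and a price range
`[pmin, pmax]` with `pmin` above the first marginal cost. Only the values of `cost` on `[0, k]`
matter; producing more than `k` units is impossible. -/
structure Setup where
  cost : ℝ → ℝ
  k : ℕ
  pmin : ℝ
  pmax : ℝ
  one_le_k : 1 ≤ k
  convex_cost : ConvexOn ℝ (Set.Icc 0 (k : ℝ)) cost
  monotone_cost : MonotoneOn cost (Set.Icc 0 (k : ℝ))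
  continuous_cost : ContinuousOn cost (Set.Icc 0 (k : ℝ))
  cost_zero : cost 0 = 0
  cost_one_lt_pmin : cost 1 < pmin
  pmin_le_pmax : pmin ≤ pmax

namespace Setup

variable (S : Setup)

/-- The marginal cost `c i = f(i) - f(i - 1)` of the `i`-th unit, for `1 ≤ i ≤ k`. -/
def marginal (i : ℕ) : ℝ := S.cost (i : ℝ) - S.cost ((i : ℝ) - 1)

open Classical in
/-- `Γ(p) = ∑_{i=1}^k i · 1[c i ≤ p < c (i + 1)]`, with `c (k + 1) = +∞`. -/
def Gam (p : ℝ) : ℕ :=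
  ∑ i ∈ Finset.Icc 1 S.k, if S.marginal i ≤ p ∧ (i < S.k → p < S.marginal (i + 1)) then i else 0

/-- The number of units worth producing when all prices are `pmin`. -/
def kLow : ℕ := S.Gam S.pmin

/-- The number of units worth producing when all prices are `pmax`. -/
def kHigh : ℕ := S.Gam S.pmax

/-- `kHigh - kLow`; the system below has `gap + 1` equations and `gap + 2` breakpoints. -/
def gap : ℕ := S.kHigh - S.kLow

/-! ### Arrival instances, offline optimum, online algorithms -/

/-- An arrival instance: a finite sequence of prices in `[pmin, pmax]`, in order of arrival. -/
def IsInstance (I : List ℝ) : Prop := ∀ p ∈ I, p ∈ Set.Icc S.pmin S.pmax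

/-- The offline optimum: the largest profit over all sets of at most `k` buyers. -/
def opt (I : List ℝ) : ℝ :=
  ((Finset.univ : Finset (Finset (Fin I.length))).filter (fun X => X.card ≤ S.k)).sup'
    ⟨∅, by simp⟩ (fun X => ∑ t ∈ X, I.get t - S.cost (X.card : ℝ))

/-- The buyers selected on the instance `I` by the decision rule `d`, which sees the prices that
have arrived so far (the current one included) and says whether the current one is accepted. -/
def selected (d : List ℝ → Bool) (I : List ℝ) : Finset (Fin I.length) :=
  Finset.univ.filter (fun t => d (I.take (t.val + 1)) = true)

/-- The profit of the decision rule `d` on the instance `I`. -/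
def profit (d : List ℝ → Bool) (I : List ℝ) : ℝ :=
  ∑ t ∈ selected d I, I.get t - S.cost ((selected d I).card : ℝ)

/-- A randomized online algorithm with random seed in `Ω`: for every seed a decision rule that
never sells more than `k` units. -/
structure Algorithm (Ω : Type*) [MeasurableSpace Ω] where
  decide : Ω → List ℝ → Bool
  measurable_decide : ∀ h : List ℝ, Measurable (fun ω => decide ω h)
  capacity : ∀ ω I, S.IsInstance I → (selected (decide ω) I).card ≤ S.k

/-- `A` with seed distribution `μ` is `α`-competitive: its expected profit is at least `1 / α` times
the offline optimum on every arrival instance. -/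
def IsCompetitive {Ω : Type*} [MeasurableSpace Ω] (A : S.Algorithm Ω) (μ : Measure Ω)
    (α : ℝ) : Prop :=
  0 < α ∧ ∀ I, S.IsInstance I → S.opt I / α ≤ ∫ ω, S.profit (A.decide ω) I ∂μ

/-! ### The system of equations that determines the lower bound -/

/-- The levels: `level i` is `q^(i+1)`, that is `pmin` for `i = 0`, `pmax` for
`i = gap + 1`, and the marginal cost of unit `kLow + i` in between. -/
def level (i : ℕ) : ℝ :=
  if i = 0 then S.pmin else if i = S.gap + 1 then S.pmax else S.marginal (S.kLow + i)

/-- `F(y) = (pmin * kLow - f(kLow)) / (pmin * y - f(y))`. -/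
def ratio (y : ℝ) : ℝ :=
  (S.pmin * S.kLow - S.cost S.kLow) / (S.pmin * y - S.cost y)

/-- `γ` is a non-decreasing positive solution of the system; the indices are shifted, `γ i` being
the `(i+1)`-st breakpoint. The second clause says that the denominator of `F(γ 0)` is positive. -/
structure IsSolution (γ : Fin (S.gap + 2) → ℝ) : Prop where
  pos : 0 < γ 0
  profit_pos : 0 < S.pmin * γ 0 - S.cost (γ 0)
  mono : Monotone γ
  last : γ (Fin.last (S.gap + 1)) = S.kHigh
  eqn : ∀ i : Fin (S.gap + 1),
    S.level (i + 1) * (S.kLow + i : ℝ)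
          / Real.exp (S.ratio (γ 0) / (S.kLow + i : ℝ) * γ i.succ)
        - S.level i * (S.kLow + i : ℝ)
          / Real.exp (S.ratio (γ 0) / (S.kLow + i : ℝ) * γ i.castSucc)
      = - ∫ y in (γ i.castSucc)..(γ i.succ),
          S.ratio (γ 0) * deriv S.cost y / Real.exp (S.ratio (γ 0) / (S.kLow + i : ℝ) * y)

end Setup

end OSCC

end

noncomputable section

namespace OSCC
namespace Setup
variable (S : Setup)

/-! ### Marginal costs -/

/-! Each equation of the system is the linear differential equation `K * p' = α * (p - f')` in
integrated form, with `K = kLow + i`: the price `p` runs from one level to the next while the number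
of units sold runs between two breakpoints (`equation_iff`). Let `Q` be the revenue, so `Q' = p`.
Then the system says `α * (Q - f) = K * p - f(K)` on each piece (`IsKnots.isPath`). When `K` units
are optimal at price `p`, the right side is `best p`, the offline optimum against many buyers at
`p`. A solution is thus a revenue curve whose profit stays at a fraction `1/α` of the optimum and
whose price is `pmax` at `kHigh` units.

Lower bound: offer `k` buyers at each price of a fine ladder from `pmin` to `pmax`. The expected
counts and revenues of a `β`-competitive algorithm form a schedule (`IsCompetitive.isSchedule`);
bounding the cost below by its chords replaces Jensen's inequality. If `β < α`, the schedule cannot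
overtake `Q`: at a contact point it would have to earn `best p / β` where `Q` earns at most about
`best p / α` (`IsPath.add_mul_le`). At the top this gives `best pmax ≤ β * (Q - f)(kHigh)`, while
the same profit times `α` equals `best pmax` (`IsSchedule.false`).

Uniqueness: the same crossing argument, applied to two solutions, forces equal parameters
(`IsKnots.rate_le`); strict growth of the price on all pieces but the last then fixes the
breakpoints. As `f` is merely convex, growth can fail only where `f` rises at least as fast as
revenue (`GrowsBeyond`), and from there the price never reaches a higher level.

Existence: solve `Q' = priceOf (α * (Q - f))`, choose `α` by the intermediate value theorem so that
the final profit is right (`exists_rate`), and take as breakpoints the first times at which the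
profit reaches the thresholds (`exists_isKnots`). -/

theorem cost_nonneg {y : ℝ} (hy : y ∈ Set.Icc 0 (S.k : ℝ)) : 0 ≤ S.cost y := by
  have h := S.monotone_cost (Set.left_mem_Icc.2 (Nat.cast_nonneg _)) hy hy.1
  rwa [S.cost_zero] at h

theorem natCast_mem {i : ℕ} (hi : i ≤ S.k) : (i : ℝ) ∈ Set.Icc 0 (S.k : ℝ) :=
  ⟨Nat.cast_nonneg _, by exact_mod_cast hi⟩

/-- The chord of the cost over `[j - 1, j]`, as an affine function. -/
def line (j : ℕ) (y : ℝ) : ℝ := S.cost j + S.marginal j * (y - j)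

/-- Outside `[j - 1, j]` the chord is below the cost. -/
theorem line_le {j : ℕ} (h1 : 1 ≤ j) (hk : j ≤ S.k) {y : ℝ} (hy : y ∈ Set.Icc 0 (S.k : ℝ))
    (h : y ≤ j - 1 ∨ (j : ℝ) ≤ y) : S.line j y ≤ S.cost y := by
  have hj : (1 : ℝ) ≤ j := by exact_mod_cast h1
  have hjk : (j : ℝ) ≤ S.k := by exact_mod_cast hk
  unfold line marginal
  rcases h with h | h
  · rcases h.eq_or_lt with h | h
    · subst h; linarith
    · have := S.convex_cost.slope_mono_adjacent hy (S.natCast_mem hk) h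
        (by linarith : (j : ℝ) - 1 < j)
      rw [show (j : ℝ) - (j - 1) = 1 by ring, div_one, div_le_iff₀ (by linarith)] at this
      nlinarith
  · rcases h.eq_or_lt with h | h
    · subst h; linarith
    · have := S.convex_cost.slope_mono_adjacent (x := (j : ℝ) - 1) (y := j)
        ⟨by linarith, by linarith⟩ hy (by linarith) h
      rw [show (j : ℝ) - (j - 1) = 1 by ring, div_one, le_div_iff₀ (by linarith)] at this
      linarith

/-- On `[j - 1, j]` the chord is above the cost. -/
theorem le_line {j : ℕ} (h1 : 1 ≤ j) (hk : j ≤ S.k) {y : ℝ} (hy : y ∈ Set.Icc ((j : ℝ) - 1) j) :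
    S.cost y ≤ S.line j y := by
  have hj : (1 : ℝ) ≤ j := by exact_mod_cast h1
  have hjk : (j : ℝ) ≤ S.k := by exact_mod_cast hk
  have := S.convex_cost.2
    (show (j : ℝ) - 1 ∈ Set.Icc 0 (S.k : ℝ) from ⟨by linarith, by linarith⟩) (S.natCast_mem hk)
    (show (0 : ℝ) ≤ j - y by linarith [hy.2]) (show (0 : ℝ) ≤ y - (j - 1) by linarith [hy.1])
    (by ring)
  simp only [smul_eq_mul] at this
  rw [show ((j : ℝ) - y) * ((j : ℝ) - 1) + (y - ((j : ℝ) - 1)) * j = y by ring] at this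
  unfold line marginal
  linarith

theorem line_natCast_le {j : ℕ} (h1 : 1 ≤ j) (hk : j ≤ S.k) {n : ℕ} (hn : n ≤ S.k) :
    S.line j n ≤ S.cost n := by
  refine S.line_le h1 hk (S.natCast_mem hn) ?_
  rcases lt_or_ge n j with h | h
  · left
    have : (n : ℝ) + 1 ≤ j := by exact_mod_cast h
    linarith
  · right; exact_mod_cast h

theorem line_succ (j : ℕ) (y : ℝ) :
    S.line (j + 1) y = S.cost j + S.marginal (j + 1) * (y - j) := by
  unfold line marginal
  push_cast
  rw [show (j : ℝ) + 1 - 1 = j by ring]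
  ring

theorem marginal_mono {i j : ℕ} (hi : 1 ≤ i) (hij : i ≤ j) (hj : j ≤ S.k) :
    S.marginal i ≤ S.marginal j := by
  induction j, hij using Nat.le_induction with
  | base => exact le_rfl
  | succ j hij ih =>
    refine (ih (by omega)).trans ?_
    have := S.line_natCast_le (j := j + 1) (n := j - 1) (by omega) hj (by omega)
    rw [line_succ, Nat.cast_sub (by omega)] at this
    unfold marginal at this ⊢
    push_cast at this ⊢
    linarith

/-- The largest surplus at price `p` is attained at any unit whose marginal cost is at most `p`
while the next one's is at least `p`; lower half. -/
theorem surplus_le_of_marginal_le {i K : ℕ} (hK : 1 ≤ K) (hKk : K ≤ S.k) (hi : i ≤ K) {p : ℝ}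
    (hp : S.marginal K ≤ p) : i * p - S.cost i ≤ K * p - S.cost K := by
  have := S.line_natCast_le hK hKk (hi.trans hKk)
  have hiK : (i : ℝ) ≤ K := by exact_mod_cast hi
  unfold line at this
  nlinarith

theorem surplus_le_of_le_marginal {i K : ℕ} (hi : K ≤ i) (hik : i ≤ S.k) {p : ℝ}
    (hp : K < S.k → p ≤ S.marginal (K + 1)) : i * p - S.cost i ≤ K * p - S.cost K := by
  rcases hi.eq_or_lt with rfl | hlt
  · exact le_rfl
  have := S.line_natCast_le (j := K + 1) (by omega) (by omega) hik
  have hiK : (K : ℝ) ≤ i := by exact_mod_cast hi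
  rw [line_succ] at this
  have := hp (by omega)
  nlinarith

/-- Marginal costs are non-decreasing, so exactly one term of the defining sum is non-zero: the
largest unit whose marginal cost is at most `p`. Unit 1 qualifies because `cost 1 < pmin`. -/
theorem Gam_spec {p : ℝ} (hp : S.pmin ≤ p) :
    1 ≤ S.Gam p ∧ S.Gam p ≤ S.k ∧ S.marginal (S.Gam p) ≤ p ∧
      (S.Gam p < S.k → p < S.marginal (S.Gam p + 1)) := by
  classical
  have hc1 : S.marginal 1 ≤ p := by
    have := S.cost_one_lt_pmin
    simp [marginal, S.cost_zero]
    linarith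
  let P : ℕ → Prop := fun i => 1 ≤ i ∧ S.marginal i ≤ p
  set K := Nat.findGreatest P S.k with hK
  have hPK : P K := Nat.findGreatest_spec (m := 1) S.one_le_k ⟨le_rfl, hc1⟩
  have hKk : K ≤ S.k := Nat.findGreatest_le _
  have hnext : ∀ i, K < i → i ≤ S.k → p < S.marginal i := fun i h1 h2 => by
    by_contra h
    exact Nat.findGreatest_is_greatest h1 h2 ⟨by omega, not_lt.1 h⟩
  have hG : S.Gam p = K := by
    unfold Gam
    rw [Finset.sum_eq_single K]
    · rw [if_pos ⟨hPK.2, fun h => hnext _ (Nat.lt_succ_self _) h⟩]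
    · intro i hi hne
      rw [Finset.mem_Icc] at hi
      rw [if_neg]
      rintro ⟨h1, h2⟩
      rcases lt_or_gt_of_ne hne with h | h
      · have := h2 (by omega)
        have := S.marginal_mono (i := i + 1) (j := K) (by omega) h hKk
        linarith [hPK.2]
      · exact absurd h1 (not_le.2 (hnext i h hi.2))
    · intro h
      exact absurd (Finset.mem_Icc.2 ⟨hPK.1, hKk⟩) h
  rw [hG]
  exact ⟨hPK.1, hKk, hPK.2, fun h => hnext _ (Nat.lt_succ_self _) h⟩

theorem one_le_kLow : 1 ≤ S.kLow := (S.Gam_spec le_rfl).1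

theorem kLow_le_kHigh : S.kLow ≤ S.kHigh := by
  by_contra! h
  have h1 := S.Gam_spec le_rfl
  have h2 := S.Gam_spec S.pmin_le_pmax
  change _ ∧ S.kLow ≤ _ ∧ S.marginal S.kLow ≤ _ ∧ _ at h1
  change _ ∧ _ ∧ _ ∧ (S.kHigh < _ → _ < S.marginal (S.kHigh + 1)) at h2
  have := S.marginal_mono (i := S.kHigh + 1) (j := S.kLow) (by omega) h h1.2.1
  linarith [h2.2.2.2 (by omega), S.pmin_le_pmax]

theorem kHigh_le_k : S.kHigh ≤ S.k := (S.Gam_spec S.pmin_le_pmax).2.1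

theorem kLow_add_gap : S.kLow + S.gap = S.kHigh := by
  have := S.kLow_le_kHigh
  unfold gap
  omega

theorem kLow_add_le {i : ℕ} (hi : i ≤ S.gap) : S.kLow + i ≤ S.kHigh := by
  have := S.kLow_add_gap
  omega

theorem pmin_pos : 0 < S.pmin := by
  have := S.cost_nonneg (y := 1) ⟨by norm_num, by exact_mod_cast S.one_le_k⟩
  linarith [S.cost_one_lt_pmin]

/-! ### Levels -/

theorem level_zero : S.level 0 = S.pmin := by simp [level]

theorem level_last : S.level (S.gap + 1) = S.pmax := by simp [level]

theorem level_mid {i : ℕ} (h0 : 1 ≤ i) (hi : i ≤ S.gap) :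
    S.level i = S.marginal (S.kLow + i) := by
  unfold level
  rw [if_neg (by omega), if_neg (by omega)]

theorem marginal_le_level {i : ℕ} (hi : i ≤ S.gap) : S.marginal (S.kLow + i) ≤ S.level i := by
  rcases Nat.eq_zero_or_pos i with rfl | h
  · rw [level_zero]
    exact (S.Gam_spec le_rfl).2.2.1
  · exact (S.level_mid h hi).ge

theorem level_succ_le_marginal {i : ℕ} (hi : i ≤ S.gap) (hk : S.kLow + i < S.k) :
    S.level (i + 1) ≤ S.marginal (S.kLow + i + 1) := by
  rcases hi.eq_or_lt with rfl | h
  · rw [level_last, kLow_add_gap]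
    rw [kLow_add_gap] at hk
    exact ((S.Gam_spec S.pmin_le_pmax).2.2.2 hk).le
  · rw [S.level_mid (by omega) (by omega)]
    rfl

theorem level_le_succ {i : ℕ} (hi : i ≤ S.gap) : S.level i ≤ S.level (i + 1) := by
  rcases hi.eq_or_lt with rfl | h
  · rw [level_last]
    rcases Nat.eq_zero_or_pos S.gap with h0 | h0
    · rw [h0, level_zero]; exact S.pmin_le_pmax
    · rw [S.level_mid h0 le_rfl, kLow_add_gap]
      exact (S.Gam_spec S.pmin_le_pmax).2.2.1
  · rw [S.level_mid (by omega) (by omega : i + 1 ≤ S.gap)]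
    have hk := S.kHigh_le_k
    have hg := S.kLow_add_gap
    rcases Nat.eq_zero_or_pos i with rfl | h0
    · rw [level_zero]
      exact ((S.Gam_spec le_rfl).2.2.2 (show S.kLow < S.k by omega)).le
    · rw [S.level_mid h0 hi]
      exact S.marginal_mono (by have := S.one_le_kLow; omega) (by omega) (by omega)

theorem level_mono {i j : ℕ} (hij : i ≤ j) (hj : j ≤ S.gap + 1) : S.level i ≤ S.level j := by
  induction j, hij using Nat.le_induction with
  | base => exact le_rfl
  | succ j _ ih => exact (ih (by omega)).trans (S.level_le_succ (by omega))

theorem pmin_le_level {i : ℕ} (hi : i ≤ S.gap + 1) : S.pmin ≤ S.level i :=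
  S.level_zero ▸ S.level_mono (Nat.zero_le _) hi

/-- Between two consecutive levels, `kLow + i` units maximize the surplus. -/
theorem surplus_le {i n : ℕ} (hi : i ≤ S.gap) (hn : n ≤ S.kHigh) {p : ℝ}
    (h1 : S.level i ≤ p) (h2 : i < S.gap → p ≤ S.level (i + 1)) :
    n * p - S.cost n ≤ (S.kLow + i : ℕ) * p - S.cost (S.kLow + i : ℕ) := by
  have hg := S.kLow_add_gap
  have hk := S.kHigh_le_k
  rcases le_total n (S.kLow + i) with h | h
  · exact S.surplus_le_of_marginal_le (by have := S.one_le_kLow; omega) (by omega) h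
      ((S.marginal_le_level hi).trans h1)
  · rcases hi.eq_or_lt with rfl | hlt
    · obtain rfl : n = S.kLow + S.gap := by omega
      exact le_rfl
    · exact S.surplus_le_of_le_marginal h (by omega) fun hlt' =>
        (h2 hlt).trans (S.level_succ_le_marginal hi hlt')

/-- At `pmin`, the surplus is maximized by `kLow` units among all `n ≤ k`. -/
theorem surplus_pmin_le {n : ℕ} (hn : n ≤ S.k) :
    n * S.pmin - S.cost n ≤ S.kLow * S.pmin - S.cost S.kLow := by
  have h := S.Gam_spec le_rfl
  rcases le_total n S.kLow with h' | h'
  · exact S.surplus_le_of_marginal_le h.1 h.2.1 h' h.2.2.1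
  · exact S.surplus_le_of_le_marginal h' hn fun hlt => (h.2.2.2 hlt).le

theorem surplus_kLow_pos : 0 < S.pmin * S.kLow - S.cost S.kLow := by
  have := S.surplus_pmin_le (n := 1) S.one_le_k
  have := S.cost_one_lt_pmin
  push_cast at *
  linarith

/-! ### Thresholds and the offline optimum at a constant price -/

/-- The value of `kLow + i` units at level `i`. -/
def threshold (i : ℕ) : ℝ := (S.kLow + i) * S.level i - S.cost (S.kLow + i)

/-- A price equal to the marginal cost of the next unit makes that unit worth nothing, so both
counts give the same surplus. This is what makes consecutive pieces of a path fit together. -/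
theorem threshold_succ {i : ℕ} (hi : i < S.gap) :
    (S.kLow + i : ℝ) * S.level (i + 1) - S.cost (S.kLow + i) = S.threshold (i + 1) := by
  unfold threshold
  rw [S.level_mid (by omega) (by omega : i + 1 ≤ S.gap)]
  unfold marginal
  push_cast
  rw [show (S.kLow : ℝ) + (i + 1) - 1 = S.kLow + i by ring]
  ring

theorem threshold_zero : S.threshold 0 = S.pmin * S.kLow - S.cost S.kLow := by
  simp [threshold, level_zero]
  ring

/-- The offline optimum when arbitrarily many buyers offer `p`, capped at `kHigh` units. -/
def best (p : ℝ) : ℝ :=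
  (Finset.range (S.kHigh + 1)).sup' ⟨0, by simp⟩ fun n => (n : ℝ) * p - S.cost n

theorem le_best {n : ℕ} (hn : n ≤ S.kHigh) (p : ℝ) : n * p - S.cost n ≤ S.best p :=
  Finset.le_sup' (fun n : ℕ => (n : ℝ) * p - S.cost n) (Finset.mem_range.2 (by omega))

theorem best_le {p b : ℝ} (h : ∀ n ≤ S.kHigh, (n : ℝ) * p - S.cost n ≤ b) : S.best p ≤ b :=
  Finset.sup'_le _ _ fun n hn => h n (by have := Finset.mem_range.1 hn; omega)

theorem best_mono : Monotone S.best := fun p q hpq => S.best_le fun n hn =>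
  le_trans (by gcongr) (S.le_best hn q)

/-- At most `kHigh` units profit from the higher price. This controls the error of replacing a
continuum of prices by a ladder. -/
theorem best_add_le {p δ : ℝ} (hδ : 0 ≤ δ) : S.best (p + δ) ≤ S.best p + S.kHigh * δ :=
  S.best_le fun n hn => by
    have h1 := S.le_best hn p
    have h2 : (n : ℝ) ≤ S.kHigh := by exact_mod_cast hn
    nlinarith

theorem best_eq {i : ℕ} (hi : i ≤ S.gap) {p : ℝ} (h1 : S.level i ≤ p)
    (h2 : i < S.gap → p ≤ S.level (i + 1)) :
    S.best p = (S.kLow + i) * p - S.cost (S.kLow + i) := by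
  refine le_antisymm (S.best_le fun n hn => ?_) ?_
  · simpa using S.surplus_le hi hn h1 h2
  · simpa using S.le_best (S.kLow_add_le hi) p

theorem best_pmin_pos : 0 < S.best S.pmin := by
  have := S.le_best S.kLow_le_kHigh S.pmin
  have := S.surplus_kLow_pos
  linarith

theorem best_pmax : S.best S.pmax = S.kHigh * S.pmax - S.cost S.kHigh := by
  have := S.best_eq le_rfl (p := S.pmax) (S.level_last ▸ S.level_le_succ le_rfl)
    (fun h => absurd h (lt_irrefl _))
  rw [this, ← S.kLow_add_gap]
  push_cast
  ring

end Setup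

/-! ### Absolute continuity of the cost -/

theorem absolutelyContinuousOnInterval_congr {f g : ℝ → ℝ} {a b : ℝ}
    (hf : AbsolutelyContinuousOnInterval f a b) (h : Set.EqOn f g (Set.uIcc a b)) :
    AbsolutelyContinuousOnInterval g a b := by
  rw [absolutelyContinuousOnInterval_iff] at hf ⊢
  intro ε hε
  obtain ⟨δ, hδ, H⟩ := hf ε hε
  refine ⟨δ, hδ, fun E hE hs => ?_⟩
  have := H E hE hs
  rwa [Finset.sum_congr rfl fun i hi => by
    rw [h (hE.1 i hi).1, h (hE.1 i hi).2]] at this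

/-- A continuous monotone convex function on a compact interval is absolutely continuous. -/
theorem _root_.ConvexOn.absolutelyContinuousOnInterval {f : ℝ → ℝ} {a b : ℝ} (hab : a ≤ b)
    (hf : ConvexOn ℝ (Set.Icc a b) f) (hm : MonotoneOn f (Set.Icc a b))
    (hc : ContinuousOn f (Set.Icc a b)) : AbsolutelyContinuousOnInterval f a b := by
  -- The right derivative exists at every interior point and is non-negative by monotonicity, hence
  -- integrable; `f` is its indefinite integral plus a constant.
  set f' : ℝ → ℝ := fun x => derivWithin f (Set.Ioi x) x
  have hd : ∀ x ∈ Set.Ioo a b, HasDerivWithinAt f (f' x) (Set.Ioi x) x := fun x hx =>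
    hf.hasDerivWithinAt_rightDeriv_of_mem_interior (by rwa [interior_Icc])
  have hnn : ∀ x ∈ Set.Ioo a b, 0 ≤ f' x := fun x hx => by
    have h := hd x hx
    rw [hasDerivWithinAt_iff_tendsto_slope' (by simp)] at h
    refine ge_of_tendsto h ?_
    filter_upwards [Ioo_mem_nhdsGT hx.2] with y hy
    rw [slope_def_field]
    refine div_nonneg (sub_nonneg.2 (hm ?_ ?_ hy.1.le)) (sub_nonneg.2 hy.1.le)
    · exact ⟨hx.1.le, hx.2.le⟩
    · exact ⟨hx.1.le.trans hy.1.le, hy.2.le⟩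
  have hi : IntervalIntegrable f' volume a b := by
    rw [intervalIntegrable_iff_integrableOn_Ioc_of_le hab]
    exact intervalIntegral.integrableOn_deriv_right_of_nonneg hc hd hnn
  have hac := hi.absolutelyContinuousOnInterval_intervalIntegral (Set.left_mem_uIcc)
  have hconst : AbsolutelyContinuousOnInterval (fun _ : ℝ => f a) a b :=
    contDiffOn_const.absolutelyContinuousOnInterval
  refine absolutelyContinuousOnInterval_congr (hconst.add hac) fun x hx => ?_
  rw [Set.uIcc_of_le hab] at hx
  have := intervalIntegral.integral_eq_sub_of_hasDeriv_right_of_le hx.1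
    (hc.mono (Set.Icc_subset_Icc_right hx.2))
    (fun y hy => hd y ⟨hy.1, hy.2.trans_le hx.2⟩)
    (hi.mono_set (by rw [Set.uIcc_of_le hab, Set.uIcc_of_le hx.1]
                     exact Set.Icc_subset_Icc_right hx.2))
  simp only [Pi.add_apply]
  linarith

/-! ### Removing the derivative of the cost from the equations -/

namespace Setup
variable (S : Setup)

/-- The cost extended from `[0, k]` to a continuous function on the line. -/
def ext (y : ℝ) : ℝ := S.cost (max 0 (min y S.k))

theorem ext_eq {y : ℝ} (hy : y ∈ Set.Icc 0 (S.k : ℝ)) : S.ext y = S.cost y := by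
  unfold ext
  rw [min_eq_left hy.2, max_eq_right hy.1]

theorem clamp_mem (y : ℝ) : max 0 (min y (S.k : ℝ)) ∈ Set.Icc 0 (S.k : ℝ) :=
  ⟨le_max_left _ _, max_le (Nat.cast_nonneg _) (min_le_right _ _)⟩

theorem continuous_ext : Continuous S.ext :=
  S.continuous_cost.comp_continuous (by fun_prop) S.clamp_mem

theorem ext_nonneg (y : ℝ) : 0 ≤ S.ext y := S.cost_nonneg (S.clamp_mem y)

/-- Integration by parts for the right-hand side of the system of equations. -/
theorem integral_deriv_cost {a b : ℝ} (ha : 0 ≤ a) (hab : a ≤ b) (hb : b ≤ S.k) (α c : ℝ) :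
    ∫ y in a..b, α * deriv S.cost y / Real.exp (c * y) =
      α * (S.cost b / Real.exp (c * b) - S.cost a / Real.exp (c * a))
        + α * c * ∫ y in a..b, S.ext y / Real.exp (c * y) := by
  -- The cost need not be differentiable everywhere; absolute continuity justifies the integration
  -- by parts.
  have hac : AbsolutelyContinuousOnInterval S.cost a b :=
    (S.convex_cost.absolutelyContinuousOnInterval (Nat.cast_nonneg _) S.monotone_cost
      S.continuous_cost).mono (by
        rw [Set.uIcc_of_le hab, Set.uIcc_of_le (Nat.cast_nonneg _)]
        exact Set.Icc_subset_Icc ha hb)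
  have hg : AbsolutelyContinuousOnInterval (fun y => Real.exp (-(c * y))) a b :=
    ContDiffOn.absolutelyContinuousOnInterval (by fun_prop)
  have hp := hg.integral_mul_deriv_eq_deriv_mul hac
  have hd : ∀ y, deriv (fun y => Real.exp (-(c * y))) y = -c * Real.exp (-(c * y)) := fun y => by
    have : HasDerivAt (fun y => Real.exp (-(c * y))) (Real.exp (-(c * y)) * (-(c * 1))) y :=
      (((hasDerivAt_id y).const_mul c).neg).exp
    rw [this.deriv]; ring
  have h1 : ∫ y in a..b, α * deriv S.cost y / Real.exp (c * y)
      = α * ∫ y in a..b, Real.exp (-(c * y)) * deriv S.cost y := by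
    rw [← intervalIntegral.integral_const_mul]
    congr 1; ext y
    rw [Real.exp_neg]; field_simp
  have h2 : ∫ y in a..b, deriv (fun y => Real.exp (-(c * y))) y * S.cost y
      = -c * ∫ y in a..b, S.ext y / Real.exp (c * y) := by
    rw [← intervalIntegral.integral_const_mul]
    refine intervalIntegral.integral_congr fun y hy => ?_
    rw [Set.uIcc_of_le hab] at hy
    simp only [hd]
    rw [S.ext_eq ⟨ha.trans hy.1, hy.2.trans hb⟩, Real.exp_neg]
    field_simp
  rw [h1, hp, h2]
  simp only [Real.exp_neg]
  ring

end Setup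

namespace Setup
variable (S : Setup)

/-! ### Price paths -/

/-- The solution of `K * p' = α * (p - cost')` with value `l` at `a`. -/
def price (α K a l y : ℝ) : ℝ :=
  (Real.exp (α / K * y) * ((K * l + α * S.ext a) / Real.exp (α / K * a)
    - α * (α / K) * ∫ s in a..y, S.ext s / Real.exp (α / K * s)) - α * S.ext y) / K

theorem continuous_ext_div_exp (c : ℝ) : Continuous fun s => S.ext s / Real.exp (c * s) :=
  S.continuous_ext.div (by fun_prop) fun _ => (Real.exp_pos _).ne'

theorem price_self (α : ℝ) {K : ℝ} (hK : 0 < K) (a l : ℝ) : S.price α K a l a = l := by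
  unfold price
  rw [intervalIntegral.integral_same, mul_zero, sub_zero,
    mul_div_cancel₀ _ (Real.exp_pos _).ne']
  field_simp
  ring

/-- Neither the price nor the cost need be differentiable, but `K * price + α * ext` is: the kinks
cancel. This is the form of the differential equation used throughout. -/
theorem hasDerivAt_price (α : ℝ) {K : ℝ} (hK : 0 < K) (a l y : ℝ) :
    HasDerivAt (fun y => K * S.price α K a l y + α * S.ext y) (α * S.price α K a l y) y := by
  have h1 : (fun y => K * S.price α K a l y + α * S.ext y) = fun y =>
      Real.exp (α / K * y) * ((K * l + α * S.ext a) / Real.exp (α / K * a)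
        - α * (α / K) * ∫ s in a..y, S.ext s / Real.exp (α / K * s)) := by
    ext y
    unfold price
    field_simp
    ring
  rw [h1]
  have h2 : HasDerivAt (fun y => ∫ s in a..y, S.ext s / Real.exp (α / K * s))
      (S.ext y / Real.exp (α / K * y)) y :=
    (S.continuous_ext_div_exp _).integral_hasStrictDerivAt a y |>.hasDerivAt
  have h3 : HasDerivAt (fun y => Real.exp (α / K * y)) (Real.exp (α / K * y) * (α / K * 1)) y :=
    ((hasDerivAt_id y).const_mul _).exp
  convert! h3.mul ((h2.const_mul (α * (α / K))).const_sub _) using 1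
  unfold price
  have := (Real.exp_pos (α / K * y)).ne'
  field_simp
  ring

theorem continuous_price (α : ℝ) {K : ℝ} (hK : 0 < K) (a l : ℝ) :
    Continuous (S.price α K a l) := by
  have h : S.price α K a l = fun y =>
      ((K * S.price α K a l y + α * S.ext y) - α * S.ext y) / K := by
    ext y
    field_simp
    ring
  have h' : Continuous fun y => K * S.price α K a l y + α * S.ext y :=
    continuous_iff_continuousAt.2 fun y => (S.hasDerivAt_price α hK a l y).continuousAt
  rw [h]
  exact (h'.sub (S.continuous_ext.const_mul α)).div_const K

/-- After integration by parts the equation is linear in `l'`, and solving it for `l'` gives the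
closed formula for the price at `b`. -/
theorem equation_iff (α : ℝ) {K : ℝ} (hK : 0 < K) {a b : ℝ} (ha : 0 ≤ a) (hab : a ≤ b)
    (hb : b ≤ S.k) (l l' : ℝ) :
    l' * K / Real.exp (α / K * b) - l * K / Real.exp (α / K * a)
      = - ∫ y in a..b, α * deriv S.cost y / Real.exp (α / K * y) ↔ S.price α K a l b = l' := by
  rw [S.integral_deriv_cost ha hab hb, ← S.ext_eq ⟨ha, hab.trans hb⟩,
    ← S.ext_eq ⟨ha.trans hab, hb⟩]
  unfold price
  have ea := (Real.exp_pos (α / K * a)).ne'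
  have eb := (Real.exp_pos (α / K * b)).ne'
  set I := ∫ s in a..b, S.ext s / Real.exp (α / K * s)
  set A := Real.exp (α / K * a)
  set B := Real.exp (α / K * b)
  rw [div_eq_iff hK.ne']
  have e : l' * K / B - l * K / A - -(α * (S.ext b / B - S.ext a / A) + α * (α / K) * I)
      = (l' * K - (B * ((K * l + α * S.ext a) / A - α * (α / K) * I) - α * S.ext b)) / B := by
    field_simp
    ring
  rw [← sub_eq_zero, e, div_eq_zero_iff, or_iff_left eb, sub_eq_zero, eq_comm]

/-- Breakpoints of a solution with parameter `α`, indexed by the natural numbers. -/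
structure IsKnots (α : ℝ) (g : ℕ → ℝ) : Prop where
  rate_pos : 0 < α
  pos : 0 < g 0
  le_succ : ∀ i ≤ S.gap, g i ≤ g (i + 1)
  last : g (S.gap + 1) = S.kHigh
  start : α * (S.pmin * g 0 - S.cost (g 0)) = S.threshold 0
  price_eq : ∀ i ≤ S.gap, S.price α (S.kLow + i) (g i) (S.level i) (g (i + 1)) = S.level (i + 1)

theorem kLow_add_pos (i : ℕ) : (0 : ℝ) < S.kLow + i := by
  have : (1 : ℝ) ≤ S.kLow := by exact_mod_cast S.one_le_kLow
  positivity

namespace IsKnots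
variable {S} {α : ℝ} {g : ℕ → ℝ}

theorem mono (h : S.IsKnots α g) {i j : ℕ} (hij : i ≤ j) (hj : j ≤ S.gap + 1) : g i ≤ g j := by
  induction j, hij using Nat.le_induction with
  | base => exact le_rfl
  | succ j _ ih => exact (ih (by omega)).trans (h.le_succ _ (by omega))

theorem pos' (h : S.IsKnots α g) {i : ℕ} (hi : i ≤ S.gap + 1) : 0 < g i :=
  h.pos.trans_le (h.mono (Nat.zero_le _) hi)

theorem le_kHigh (h : S.IsKnots α g) {i : ℕ} (hi : i ≤ S.gap + 1) : g i ≤ S.kHigh :=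
  h.last ▸ h.mono hi le_rfl

theorem mem_Icc (h : S.IsKnots α g) {i : ℕ} (hi : i ≤ S.gap + 1) : g i ∈ Set.Icc 0 (S.k : ℝ) :=
  ⟨(h.pos' hi).le, (h.le_kHigh hi).trans (by exact_mod_cast S.kHigh_le_k)⟩

end IsKnots

/-- The price at which the `y`-th unit is sold along a solution. -/
def pathPrice (α : ℝ) (g : ℕ → ℝ) (y : ℝ) : ℝ :=
  S.pmin + ∑ i ∈ Finset.range (S.gap + 1),
    (S.price α (S.kLow + i) (g i) (S.level i) (max (g i) (min y (g (i + 1)))) - S.level i)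

/-- A revenue curve `Q` with marginal price `q` following the solution with breakpoints `g`. -/
structure IsPath (α : ℝ) (g : ℕ → ℝ) (Q q : ℝ → ℝ) : Prop where
  cont : Continuous q
  deriv : ∀ y, HasDerivAt Q (q y) y
  zero : Q 0 = 0
  initial : ∀ y ≤ g 0, q y = S.pmin
  at_knot : ∀ i ≤ S.gap + 1, q (g i) = S.level i
  eq_price : ∀ i ≤ S.gap, ∀ y ∈ Set.Icc (g i) (g (i + 1)),
    q y = S.price α (S.kLow + i) (g i) (S.level i) y
  piece : ∀ i ≤ S.gap, ∀ y ∈ Set.Icc (g i) (g (i + 1)),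
    α * (Q y - S.ext y) = (S.kLow + i) * q y - S.cost (S.kLow + i)

variable {S} {α : ℝ} {g : ℕ → ℝ}

theorem IsKnots.pathPrice_init (h : S.IsKnots α g) {y : ℝ} (hy : y ≤ g 0) :
    S.pathPrice α g y = S.pmin := by
  unfold pathPrice
  rw [Finset.sum_eq_zero, add_zero]
  intro i hi
  rw [Finset.mem_range] at hi
  have h1 := h.mono (Nat.zero_le i) (by omega)
  rw [max_eq_left ((min_le_left _ _).trans (hy.trans h1)), S.price_self _ (S.kLow_add_pos i),
    sub_self]

/-- The clamps make the sum telescope: earlier pieces contribute their full increments between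
levels, later ones are frozen at their left end and contribute zero. -/
theorem IsKnots.pathPrice_eq (h : S.IsKnots α g) {i : ℕ} (hi : i ≤ S.gap) {y : ℝ}
    (hy : y ∈ Set.Icc (g i) (g (i + 1))) :
    S.pathPrice α g y = S.price α (S.kLow + i) (g i) (S.level i) y := by
  have key : ∀ m ≤ S.gap + 1, ∑ j ∈ Finset.range m,
      (S.price α (S.kLow + j) (g j) (S.level j) (max (g j) (min y (g (j + 1)))) - S.level j)
      = (if m ≤ i then S.level m else S.price α (S.kLow + i) (g i) (S.level i) y)
        - S.level 0 := by
    intro m hm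
    induction m with
    | zero => simp
    | succ m ih =>
      rw [Finset.sum_range_succ, ih (by omega)]
      rcases lt_trichotomy m i with hlt | rfl | hgt
      · have h1 := h.mono (i := m + 1) (j := i) hlt (by omega)
        rw [if_pos hlt.le, if_pos (Nat.succ_le_of_lt hlt), min_eq_right (h1.trans hy.1),
          max_eq_right (h.le_succ m (by omega)), h.price_eq m (by omega)]
        ring
      · rw [if_pos le_rfl, if_neg (by omega), min_eq_left hy.2, max_eq_right hy.1]
        ring
      · have h1 := h.mono (i := i + 1) (j := m) hgt (by omega)
        rw [if_neg (by omega), if_neg (by omega),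
          max_eq_left ((min_le_left _ _).trans (hy.2.trans h1)), S.price_self _ (S.kLow_add_pos m)]
        ring
  unfold pathPrice
  rw [key _ le_rfl, if_neg (by omega), level_zero]
  ring

/-- On a piece, `K * price + α * ext` and `α * Q` have the same derivative, so their difference is
constant. Its value is fixed at the left end, by `start` for the first piece and by `threshold_succ`
for the later ones. -/
theorem IsKnots.isPath (h : S.IsKnots α g) :
    S.IsPath α g (fun y => ∫ s in (0 : ℝ)..y, S.pathPrice α g s) (S.pathPrice α g) := by
  have hc : Continuous (S.pathPrice α g) := by
    unfold pathPrice
    refine continuous_const.add (continuous_finsetSum _ fun i _ => Continuous.sub ?_ ?_)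
    · exact (S.continuous_price α (S.kLow_add_pos i) _ _).comp (by fun_prop)
    · exact continuous_const
  have hd : ∀ y, HasDerivAt (fun y => ∫ s in (0 : ℝ)..y, S.pathPrice α g s)
      (S.pathPrice α g y) y := fun y => (hc.integral_hasStrictDerivAt 0 y).hasDerivAt
  have hknot : ∀ i ≤ S.gap + 1, S.pathPrice α g (g i) = S.level i := by
    intro i hi
    rcases Nat.lt_or_ge i (S.gap + 1) with h' | h'
    · rw [h.pathPrice_eq (by omega) ⟨le_rfl, h.le_succ i (by omega)⟩,
        S.price_self _ (S.kLow_add_pos i)]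
    · obtain rfl : i = S.gap + 1 := by omega
      rw [h.pathPrice_eq le_rfl ⟨h.le_succ _ le_rfl, le_rfl⟩, h.price_eq _ le_rfl]
  set Q : ℝ → ℝ := fun y => ∫ s in (0 : ℝ)..y, S.pathPrice α g s with hQ
  have step : ∀ i ≤ S.gap, α * (Q (g i) - S.ext (g i)) = S.threshold i →
      ∀ y ∈ Set.Icc (g i) (g (i + 1)),
        α * (Q y - S.ext y) = (S.kLow + i) * S.pathPrice α g y - S.cost (S.kLow + i) := by
    intro i hi h0 y hy
    have hconst := constant_of_has_deriv_right_zero (a := g i) (b := g (i + 1))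
      (f := fun y => ((S.kLow + i) * S.price α (S.kLow + i) (g i) (S.level i) y + α * S.ext y)
        - α * Q y)
      (fun x _ => ((S.hasDerivAt_price α (S.kLow_add_pos i) _ _ x).sub
        ((hd x).const_mul α)).continuousAt.continuousWithinAt)
      (fun x hx => by
        have := ((S.hasDerivAt_price α (S.kLow_add_pos i) (g i) (S.level i) x).sub
          ((hd x).const_mul α)).hasDerivWithinAt (s := Set.Ici x)
        rwa [h.pathPrice_eq hi ⟨hx.1, hx.2.le⟩, sub_self] at this)
      y hy
    simp only [S.price_self _ (S.kLow_add_pos i)] at hconst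
    rw [h.pathPrice_eq hi hy]
    unfold threshold at h0
    linarith
  have hth : ∀ i ≤ S.gap, α * (Q (g i) - S.ext (g i)) = S.threshold i := by
    intro i
    induction i with
    | zero =>
      intro _
      rw [← h.start, S.ext_eq (h.mem_Icc (Nat.zero_le _)), hQ]
      simp only
      rw [intervalIntegral.integral_congr (g := fun _ => S.pmin)]
      · rw [intervalIntegral.integral_const, smul_eq_mul]
        ring
      · intro s hs
        rw [Set.uIcc_of_le h.pos.le] at hs
        exact h.pathPrice_init hs.2
    | succ i ih =>
      intro hi
      rw [step i (by omega) (ih (by omega)) _ ⟨h.le_succ i (by omega), le_rfl⟩,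
        hknot _ (by omega), S.threshold_succ hi]
  exact ⟨hc, hd, intervalIntegral.integral_same, fun y hy => h.pathPrice_init hy, hknot,
    fun i hi y hy => h.pathPrice_eq hi hy, fun i hi => step i hi (hth i hi)⟩

end Setup

/-! ### One-sided comparison with a convex function -/

theorem deriv_le_of_sub_le {Q : ℝ → ℝ} {m σ x b : ℝ} (hQ : HasDerivAt Q m x) (hb : x < b)
    (h : ∀ y ∈ Set.Ioo x b, Q y - Q x ≤ σ * (y - x)) : m ≤ σ := by
  have h1 := hQ.hasDerivWithinAt (s := Set.Ioi x)
  rw [hasDerivWithinAt_iff_tendsto_slope' (by simp)] at h1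
  refine le_of_tendsto h1 ?_
  filter_upwards [Ioo_mem_nhdsGT hb] with y hy
  rw [slope_def_field, div_le_iff₀ (sub_pos.2 hy.1)]
  exact h y hy

theorem le_deriv_of_le_sub {Q : ℝ → ℝ} {m σ x b : ℝ} (hQ : HasDerivAt Q m x) (hb : x < b)
    (h : ∀ y ∈ Set.Ioo x b, σ * (y - x) ≤ Q y - Q x) : σ ≤ m := by
  have := deriv_le_of_sub_le (σ := -σ) hQ.neg hb fun y hy => by
    have := h y hy
    simp only [Pi.neg_apply]
    linarith
  linarith

theorem mul_sub_le_sub_of_le_deriv {Q q : ℝ → ℝ} (hd : ∀ y, HasDerivAt Q (q y) y) {m a b : ℝ}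
    (hab : a ≤ b) (h : ∀ y ∈ Set.Icc a b, m ≤ q y) : m * (b - a) ≤ Q b - Q a := by
  refine (convex_Icc a b).mul_sub_le_image_sub_of_le_deriv
    (fun y _ => (hd y).continuousAt.continuousWithinAt)
    (fun y _ => (hd y).differentiableAt.differentiableWithinAt) (fun y hy => ?_)
    a (Set.left_mem_Icc.2 hab) b (Set.right_mem_Icc.2 hab) hab
  rw [(hd y).deriv]
  exact h y (interior_subset hy)

/-- If the slope `q` of `Q` is a monotone function of `Q - f`, with `f` convex, then `Q - f` is
quasi-concave. -/
theorem min_le_of_slope_monotone {Q q f : ℝ → ℝ} (hd : ∀ y, HasDerivAt Q (q y) y)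
    {y₁ y₂ y₃ : ℝ} (hf : ConvexOn ℝ (Set.Icc y₁ y₃) f) (hc : ContinuousOn f (Set.Icc y₁ y₃))
    (hm : ∀ s ∈ Set.Icc y₁ y₃, ∀ t ∈ Set.Icc y₁ y₃, Q s - f s ≤ Q t - f t → q s ≤ q t)
    (h2 : y₂ ∈ Set.Icc y₁ y₃) : min (Q y₁ - f y₁) (Q y₃ - f y₃) ≤ Q y₂ - f y₂ := by
  by_contra! hlt
  obtain ⟨hlt1, hlt3⟩ := lt_min_iff.1 hlt
  have hQc : Continuous Q := continuous_iff_continuousAt.2 fun y => (hd y).continuousAt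
  -- At a minimum `x` of `Q - f` the slope `q` is minimal too. Since `Q - f` is larger at `y₁`, the
  -- slope of `f` from `y₁` to `x` exceeds `q x`; by convexity `f` keeps that slope to the right,
  -- and minimality forces `Q` to do so as well, contradicting `Q' = q x` at `x`.
  obtain ⟨x, hx, hmin⟩ := isCompact_Icc.exists_isMinOn ⟨y₂, h2⟩ (hQc.continuousOn.sub hc)
  have hmin' : ∀ y ∈ Set.Icc y₁ y₃, Q x - f x ≤ Q y - f y := fun y hy => hmin hy
  have hx2 := hmin' y₂ h2
  have hx1 : y₁ < x := lt_of_le_of_ne hx.1 (by rintro rfl; linarith)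
  have hx3 : x < y₃ := lt_of_le_of_ne hx.2 (by rintro rfl; linarith)
  have hq : ∀ y ∈ Set.Icc y₁ y₃, q x ≤ q y := fun y hy => hm x hx y hy (hmin' y hy)
  have hl := mul_sub_le_sub_of_le_deriv hd hx1.le fun y hy => hq y ⟨hy.1, hy.2.trans hx.2⟩
  have hσ : q x < (f x - f y₁) / (x - y₁) := by
    rw [lt_div_iff₀ (sub_pos.2 hx1)]
    linarith
  refine absurd hσ (not_lt.2 (le_deriv_of_le_sub (hd x) hx3 fun y hy => ?_))
  have hs := hf.slope_mono_adjacent (Set.left_mem_Icc.2 (hx.1.trans hx.2))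
    ⟨hx.1.trans hy.1.le, hy.2.le⟩ hx1 hy.1
  rw [le_div_iff₀ (sub_pos.2 hy.1)] at hs
  have := hmin' y ⟨hx.1.trans hy.1.le, hy.2.le⟩
  linarith

/-- `f` grows at least at rate `m` to the right of `y`, within `[y, T]`. -/
def GrowsBeyond (f : ℝ → ℝ) (T m y : ℝ) : Prop := ∀ b ∈ Set.Icc y T, f y + m * (b - y) ≤ f b

theorem GrowsBeyond.of_le {f : ℝ → ℝ} {T m m' y y' : ℝ} (h : GrowsBeyond f T m y)
    (hf : ConvexOn ℝ (Set.Icc 0 T) f) (hy : 0 ≤ y) (hyy : y ≤ y') (hm : m' ≤ m) :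
    GrowsBeyond f T m' y' := by
  rintro b ⟨hb1, hb2⟩
  rcases hyy.eq_or_lt with rfl | h1
  · have := h b ⟨hb1, hb2⟩
    nlinarith
  rcases hb1.eq_or_lt with rfl | h2
  · simp
  have h3 := hf.slope_mono_adjacent ⟨hy, hyy.trans (hb1.trans hb2)⟩
    ⟨hy.trans (hyy.trans hb1), hb2⟩ h1 h2
  have h4 := h y' ⟨hyy, hb1.trans hb2⟩
  have h5 : m ≤ (f y' - f y) / (y' - y) := by
    rw [le_div_iff₀ (sub_pos.2 h1)]; linarith
  have h6 := (hm.trans h5).trans h3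
  rw [le_div_iff₀ (sub_pos.2 h2)] at h6
  linarith

/-- Where the slope of `Q` fails to increase while `Q - f` fails to increase, `f` grows at least
as fast as `Q`. -/
theorem exists_growsBeyond {Q q f : ℝ → ℝ} (hd : ∀ y, HasDerivAt Q (q y) y) (hqc : Continuous q)
    {T y₁ y₂ : ℝ} (hf : ConvexOn ℝ (Set.Icc 0 T) f) (h0 : 0 ≤ y₁) (h12 : y₁ < y₂)
    (hm : ∀ s ∈ Set.Icc y₁ y₂, ∀ t ∈ Set.Icc y₁ y₂, q s ≤ q t → Q s - f s ≤ Q t - f t)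
    (hq : q y₂ ≤ q y₁) : ∃ x ∈ Set.Ico y₁ y₂, GrowsBeyond f T (q x) x := by
  -- A maximum point of `q` other than the right end is needed, to have room on its right; if the
  -- maximum sits at `y₂`, then `y₁` is a maximum as well by `hq`.
  obtain ⟨x, hx, hxmax⟩ : ∃ x ∈ Set.Ico y₁ y₂, ∀ y ∈ Set.Icc y₁ y₂, q y ≤ q x := by
    obtain ⟨x, hx, hmax⟩ := isCompact_Icc.exists_isMaxOn ⟨y₁, Set.left_mem_Icc.2 h12.le⟩
      hqc.continuousOn
    rcases hx.2.eq_or_lt with rfl | hlt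
    · exact ⟨y₁, ⟨le_rfl, h12⟩, fun y hy => le_trans (hmax hy) hq⟩
    · exact ⟨x, ⟨hx.1, hlt⟩, fun y hy => hmax hy⟩
  refine ⟨x, hx, fun b hb => ?_⟩
  rcases hb.1.eq_or_lt with rfl | hxb
  · simp
  have key : q x ≤ (f b - f x) / (b - x) := by
    refine deriv_le_of_sub_le (hd x) (lt_min hxb hx.2) fun y hy => ?_
    obtain ⟨hyb, hy2⟩ := lt_min_iff.1 hy.2
    have h1 := hm y ⟨hx.1.trans hy.1.le, hy2.le⟩ x ⟨hx.1, hx.2.le⟩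
      (hxmax y ⟨hx.1.trans hy.1.le, hy2.le⟩)
    have h2 := hf.secant_mono_aux2 (x := x) (y := y) (z := b)
      ⟨h0.trans hx.1, hxb.le.trans hb.2⟩ ⟨(h0.trans hx.1).trans hb.1, hb.2⟩ hy.1 hyb
    rw [div_le_iff₀ (sub_pos.2 hy.1)] at h2
    linarith
  rw [le_div_iff₀ (sub_pos.2 hxb)] at key
  linarith

/-- If `q = Q'` is an increasing affine function of `Q - f` and `f` grows at least at rate `q y`
beyond `y`, then `q` stays below `q y`. -/
theorem slope_le_of_growsBeyond {Q q f : ℝ → ℝ} (hd : ∀ y, HasDerivAt Q (q y) y)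
    {α K C T y b : ℝ} (hα : 0 < α) (hK : 0 < K)
    (hp : ∀ s ∈ Set.Icc y b, α * (Q s - f s) = K * q s - C) (hyb : y ≤ b) (hbT : b ≤ T)
    (hg : GrowsBeyond f T (q y) y) : q b ≤ q y := by
  set m := q y
  set c := α / K
  have hE : ∀ s ∈ Set.Icc y b, q s - m ≤ c * (Q s - Q y - m * (s - y)) := by
    intro s hs
    have h1 := hp s hs
    have h2 := hp y (Set.left_mem_Icc.2 hyb)
    have h3 := hg s ⟨hs.1, hs.2.trans hbT⟩
    have h4 : K * (q s - m) = α * ((Q s - Q y) - (f s - f y)) := by linarith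
    have h5 : q s - m = c * ((Q s - Q y) - (f s - f y)) := by
      simp only [c]; field_simp; linarith
    rw [h5]
    have : 0 < c := div_pos hα hK
    gcongr
    linarith
  -- Grönwall by hand: the excess `E s = Q s - Q y - m * (s - y)` satisfies `E' ≤ c * E` and `E y =
  -- 0`, so `E ≤ 0`, and then `hE` gives `q ≤ m`.
  have hder : ∀ s, HasDerivAt (fun s => (Q s - Q y - m * (s - y)) * Real.exp (-(c * s)))
      ((q s - m * 1) * Real.exp (-(c * s))
        + (Q s - Q y - m * (s - y)) * (Real.exp (-(c * s)) * -(c * 1))) s := fun s =>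
    (((hd s).sub_const _).sub (((hasDerivAt_id s).sub_const y).const_mul m)).mul
      (((hasDerivAt_id s).const_mul c).neg.exp)
  have hanti : AntitoneOn (fun s => (Q s - Q y - m * (s - y)) * Real.exp (-(c * s)))
      (Set.Icc y b) := by
    refine antitoneOn_of_deriv_nonpos (convex_Icc y b)
      (fun s _ => (hder s).continuousAt.continuousWithinAt)
      (fun s _ => (hder s).differentiableAt.differentiableWithinAt) fun s hs => ?_
    rw [(hder s).deriv]
    have h1 := hE s (interior_subset hs)
    have h2 := Real.exp_pos (-(c * s))
    nlinarith
  have h1 := hanti (Set.left_mem_Icc.2 hyb) (Set.right_mem_Icc.2 hyb) hyb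
  simp only [sub_self, mul_zero, zero_mul] at h1
  have h2 : Q b - Q y - m * (b - y) ≤ 0 := by
    by_contra! h
    have := mul_pos h (Real.exp_pos (-(c * b)))
    linarith
  have h3 := hE b (Set.right_mem_Icc.2 hyb)
  have : 0 < c := div_pos hα hK
  nlinarith

/-! ### Bounds for price and profit along a solution -/

namespace Setup
variable {S : Setup} {α : ℝ} {g : ℕ → ℝ} {Q q : ℝ → ℝ}

theorem convexOn_ext (S : Setup) : ConvexOn ℝ (Set.Icc 0 (S.k : ℝ)) S.ext :=
  S.convex_cost.congr fun _ hy => (S.ext_eq hy).symm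

theorem IsKnots.piece_subset (h : S.IsKnots α g) {i : ℕ} (hi : i ≤ S.gap) :
    Set.Icc (g i) (g (i + 1)) ⊆ Set.Icc 0 (S.k : ℝ) :=
  Set.Icc_subset_Icc (h.mem_Icc (by omega)).1 (h.mem_Icc (by omega)).2

theorem IsKnots.exists_piece (h : S.IsKnots α g) {y : ℝ} (h0 : g 0 ≤ y) (h1 : y ≤ S.kHigh) :
    ∃ i ≤ S.gap, y ∈ Set.Icc (g i) (g (i + 1)) := by
  by_contra! hcon
  have : ∀ i ≤ S.gap + 1, g i ≤ y ∧ (i = S.gap + 1 → g i < y) := by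
    intro i
    induction i with
    | zero => exact fun _ => ⟨h0, by omega⟩
    | succ i ih =>
      intro hi
      have h2 := hcon i (by omega)
      have h3 := (ih (by omega)).1
      have h4 : g (i + 1) < y := by
        by_contra! h4
        exact h2 ⟨h3, h4⟩
      exact ⟨h4.le, fun _ => h4⟩
  have h2 := (this _ le_rfl).2 rfl
  rw [h.last] at h2
  linarith

theorem IsPath.slope_le_iff (hQ : S.IsPath α g Q q) (hα : 0 < α) {i : ℕ} (hi : i ≤ S.gap)
    {s t : ℝ} (hs : s ∈ Set.Icc (g i) (g (i + 1))) (ht : t ∈ Set.Icc (g i) (g (i + 1))) :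
    q s ≤ q t ↔ Q s - S.ext s ≤ Q t - S.ext t := by
  have h1 := hQ.piece i hi s hs
  have h2 := hQ.piece i hi t ht
  have hK := S.kLow_add_pos i
  constructor
  · intro h
    have : α * (Q s - S.ext s) ≤ α * (Q t - S.ext t) := by rw [h1, h2]; gcongr
    exact le_of_mul_le_mul_left this hα
  · intro h
    have : (S.kLow + i : ℝ) * q s ≤ (S.kLow + i) * q t := by
      have : α * (Q s - S.ext s) ≤ α * (Q t - S.ext t) := by gcongr
      linarith
    exact le_of_mul_le_mul_left this hK

/-- On a piece `q` is an increasing affine function of `Q - f`, so quasi-concavity of the latter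
bounds `q` below by its smaller end value. -/
theorem IsPath.level_le (hQ : S.IsPath α g Q q) (h : S.IsKnots α g) {i : ℕ} (hi : i ≤ S.gap)
    {y : ℝ} (hyi : y ∈ Set.Icc (g i) (g (i + 1))) : S.level i ≤ q y := by
  have h1 : g i ∈ Set.Icc (g i) (g (i + 1)) := ⟨le_rfl, h.le_succ i hi⟩
  have h2 : g (i + 1) ∈ Set.Icc (g i) (g (i + 1)) := ⟨h.le_succ i hi, le_rfl⟩
  have := min_le_of_slope_monotone hQ.deriv (S.convexOn_ext.subset (h.piece_subset hi)
    (convex_Icc _ _)) S.continuous_ext.continuousOn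
    (fun s hs t ht hst => (hQ.slope_le_iff h.rate_pos hi hs ht).2 hst) hyi
  rcases min_le_iff.1 this with h3 | h3
  · rwa [← hQ.slope_le_iff h.rate_pos hi h1 hyi, hQ.at_knot i (by omega)] at h3
  · rw [← hQ.slope_le_iff h.rate_pos hi h2 hyi, hQ.at_knot (i + 1) (by omega)] at h3
    exact (S.level_le_succ hi).trans h3

theorem IsPath.pmin_le (hQ : S.IsPath α g Q q) (h : S.IsKnots α g) {y : ℝ} (hy : y ≤ S.kHigh) :
    S.pmin ≤ q y := by
  rcases le_total y (g 0) with h0 | h0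
  · exact (hQ.initial y h0).ge
  obtain ⟨i, hi, hyi⟩ := h.exists_piece h0 hy
  exact (S.pmin_le_level (by omega)).trans (hQ.level_le h hi hyi)

theorem IsPath.eq_mul (hQ : S.IsPath α g Q q) {y : ℝ} (hy : y ∈ Set.Icc 0 (g 0)) :
    Q y = S.pmin * y := by
  have := constant_of_has_deriv_right_zero (f := fun y => Q y - S.pmin * y) (a := 0) (b := y)
    (fun x _ => ((hQ.deriv x).sub ((hasDerivAt_id x).const_mul
      S.pmin)).continuousAt.continuousWithinAt)
    (fun x hx => by
      have := ((hQ.deriv x).sub ((hasDerivAt_id x).const_mul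
        S.pmin)).hasDerivWithinAt (s := Set.Ici x)
      rwa [hQ.initial x (hx.2.le.trans hy.2), mul_one, sub_self] at this)
    y (Set.right_mem_Icc.2 hy.1)
  simp only [hQ.zero, mul_zero, sub_zero] at this
  linarith

/-- Along a solution the cost-adjusted revenue is at most the offline optimum divided by `α`. -/
theorem IsPath.le_best (hQ : S.IsPath α g Q q) (h : S.IsKnots α g)
    (hinit : ∀ y ∈ Set.Icc 0 (g 0), S.pmin * y - S.cost y ≤ S.pmin * g 0 - S.cost (g 0))
    {y : ℝ} (hy : y ∈ Set.Icc 0 (S.kHigh : ℝ)) :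
    α * (Q y - S.ext y) ≤ S.best (q y) := by
  rcases le_total y (g 0) with h0 | h0
  · have hQy := hQ.eq_mul ⟨hy.1, h0⟩
    have hk : y ∈ Set.Icc 0 (S.k : ℝ) :=
      ⟨hy.1, hy.2.trans (by exact_mod_cast S.kHigh_le_k)⟩
    have h1 := hinit y ⟨hy.1, h0⟩
    have h2 := h.start
    have h3 := S.le_best S.kLow_le_kHigh S.pmin
    rw [S.threshold_zero] at h2
    rw [hQy, S.ext_eq hk, hQ.initial y h0]
    have := mul_le_mul_of_nonneg_left h1 h.rate_pos.le
    linarith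
  · obtain ⟨i, hi, hyi⟩ := h.exists_piece h0 hy.2
    rw [hQ.piece i hi y hyi]
    simpa using S.le_best (S.kLow_add_le hi) (q y)

end Setup

/-! ### Strict growth of the price, and uniqueness -/

namespace Setup
variable {S : Setup} {α : ℝ} {g : ℕ → ℝ} {Q q : ℝ → ℝ}

/-- Once the cost grows at the rate of the current price, the price cannot rise on this piece; by
convexity the condition is inherited at the next breakpoint with its lower price, so the price is
stuck for good. -/
theorem IsPath.level_le_of_growsBeyond (hQ : S.IsPath α g Q q) (h : S.IsKnots α g) {i : ℕ}
    (hi : i ≤ S.gap) {y : ℝ} (hy : y ∈ Set.Icc (g i) (g (i + 1)))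
    (hg : GrowsBeyond S.ext S.k (q y) y) {j : ℕ} (hij : i + 1 ≤ j) (hj : j ≤ S.gap + 1) :
    S.level j ≤ q y := by
  have h0 : 0 ≤ y := (h.pos' (by omega : i ≤ S.gap + 1)).le.trans hy.1
  rw [← hQ.at_knot j hj]
  induction j, hij using Nat.le_induction with
  | base =>
    exact slope_le_of_growsBeyond hQ.deriv h.rate_pos (S.kLow_add_pos i)
      (fun s hs => hQ.piece i hi s ⟨hy.1.trans hs.1, hs.2⟩) hy.2 (h.mem_Icc hj).2 hg
  | succ j hij ih =>
    have ih := ih (by omega)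
    refine le_trans ?_ ih
    exact slope_le_of_growsBeyond hQ.deriv h.rate_pos (S.kLow_add_pos j)
      (hQ.piece j (by omega)) (h.le_succ j (by omega)) (h.mem_Icc hj).2
      (hg.of_le S.convexOn_ext h0 (hy.2.trans (h.mono hij (by omega))) ih)

/-- Some secant to the right of `x` has slope below `pmin`; by convexity so does every secant ending
at `x`. -/
theorem surplus_lt_of_not_growsBeyond {x y : ℝ} (hg : ¬ GrowsBeyond S.ext S.k S.pmin x)
    (hy : 0 ≤ y) (hyx : y < x) (hx : x ≤ S.k) :
    S.pmin * y - S.cost y < S.pmin * x - S.cost x := by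
  unfold GrowsBeyond at hg
  push Not at hg
  obtain ⟨b, hb, hlt⟩ := hg
  have hxb : x < b := lt_of_le_of_ne hb.1 (by rintro rfl; simp at hlt)
  have hs := S.convexOn_ext.slope_mono_adjacent ⟨hy, hyx.le.trans hx⟩
    ⟨(hy.trans hyx.le).trans hxb.le, hb.2⟩ hyx hxb
  have h1 : (S.ext b - S.ext x) / (b - x) < S.pmin := by
    rw [div_lt_iff₀ (sub_pos.2 hxb)]; linarith
  have h2 := hs.trans_lt h1
  rw [div_lt_iff₀ (sub_pos.2 hyx), S.ext_eq ⟨hy, hyx.le.trans hx⟩,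
    S.ext_eq ⟨hy.trans hyx.le, hx⟩] at h2
  linarith

/-- If `g 0` exceeded `kLow`, the surplus at `pmin` would still be strictly increasing up to `g 0`,
since otherwise the price could not reach level 1. So `g 0` would earn more than `kLow`, whereas
`start` with `α ≥ 1` says that it earns no more. -/
theorem IsKnots.le_kLow (h : S.IsKnots α g) (hα : 1 ≤ α) : g 0 ≤ S.kLow := by
  have hg := S.kLow_add_gap
  rcases Nat.eq_zero_or_pos S.gap with h0 | h0
  · rw [h0, add_zero] at hg
    rw [hg]
    exact h.le_kHigh (Nat.zero_le _)
  by_contra! hlt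
  have hk := S.kHigh_le_k
  have hcold : ¬ GrowsBeyond S.ext S.k S.pmin (g 0) := fun hc => by
    have hQ := h.isPath
    have h1 := hQ.level_le_of_growsBeyond h (Nat.zero_le _) ⟨le_rfl, h.le_succ 0 (Nat.zero_le _)⟩
      (by rwa [hQ.initial _ le_rfl]) (le_refl 1) (by omega)
    rw [hQ.initial _ le_rfl, S.level_mid le_rfl h0] at h1
    have := (S.Gam_spec le_rfl).2.2.2 (show S.kLow < S.k by omega)
    exact absurd this (not_lt.2 h1)
  have h1 := surplus_lt_of_not_growsBeyond hcold (Nat.cast_nonneg _) hlt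
    (h.mem_Icc (Nat.zero_le _)).2
  have h2 := h.start
  rw [S.threshold_zero] at h2
  have h3 := S.surplus_kLow_pos
  nlinarith

/-- Otherwise the price is stuck. Passing on to the next breakpoint, where the price is a level at
most `level gap < pmax`, shows that `pmax` could never be reached. -/
theorem IsPath.not_growsBeyond (hlt : S.level S.gap < S.pmax) (hQ : S.IsPath α g Q q)
    (h : S.IsKnots α g) {i : ℕ} (hi : i < S.gap) {y : ℝ} (hy : y ∈ Set.Icc (g i) (g (i + 1))) :
    ¬ GrowsBeyond S.ext S.k (q y) y := fun hg => by
  have h1 := hQ.level_le_of_growsBeyond h hi.le hy hg (j := S.gap + 1) (by omega) le_rfl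
  rw [level_last] at h1
  have hg' := hg.of_le S.convexOn_ext ((h.pos' (by omega : i ≤ S.gap + 1)).le.trans hy.1) hy.2
    (hQ.level_le_of_growsBeyond h hi.le hy hg (le_refl (i + 1)) (by omega))
  have h2 := hQ.level_le_of_growsBeyond h (i := i + 1) (by omega)
    ⟨le_rfl, h.le_succ _ (by omega)⟩ (by rwa [hQ.at_knot _ (by omega)]) (j := S.gap + 1)
    (by omega) le_rfl
  rw [hQ.at_knot _ (by omega), level_last] at h2
  have := S.level_mono (i := i + 1) (j := S.gap) (by omega) (by omega)
  linarith

theorem IsPath.not_growsBeyond_zero (hlt : S.level S.gap < S.pmax) (hQ : S.IsPath α g Q q)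
    (h : S.IsKnots α g) : ¬ GrowsBeyond S.ext S.k S.pmin (g 0) := fun hg => by
  have h1 := hQ.level_le_of_growsBeyond h (Nat.zero_le _) ⟨le_rfl, h.le_succ 0 (Nat.zero_le _)⟩
    (by rwa [hQ.initial _ le_rfl]) (j := S.gap + 1) (by omega) le_rfl
  rw [level_last, hQ.initial _ le_rfl] at h1
  have := S.pmin_le_level (i := S.gap) (by omega)
  linarith

theorem IsPath.strictMonoOn (hlt : S.level S.gap < S.pmax) (hQ : S.IsPath α g Q q)
    (h : S.IsKnots α g) {i : ℕ} (hi : i < S.gap) : StrictMonoOn q (Set.Icc (g i) (g (i + 1))) := by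
  intro a ha b hb hab
  by_contra! hle
  have hsub : Set.Icc a b ⊆ Set.Icc (g i) (g (i + 1)) := Set.Icc_subset_Icc ha.1 hb.2
  obtain ⟨x, hx, hg⟩ := exists_growsBeyond hQ.deriv hQ.cont S.convexOn_ext
    ((h.pos' (by omega : i ≤ S.gap + 1)).le.trans ha.1) hab
    (fun s hs t ht hst => (hQ.slope_le_iff h.rate_pos hi.le (hsub hs) (hsub ht)).1 hst) hle
  exact hQ.not_growsBeyond hlt h hi (hsub ⟨hx.1, hx.2.le⟩) hg

/-- Beyond `g 0` the path is tight. Before the last piece monotonicity keeps the price below the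
next level; on the last piece no upper bound is needed, because `best` never uses more than `kHigh`
units. -/
theorem IsPath.best_eq (hlt : S.level S.gap < S.pmax) (hQ : S.IsPath α g Q q)
    (h : S.IsKnots α g) {y : ℝ} (h0 : g 0 ≤ y) (hy : y ≤ S.kHigh) :
    S.best (q y) = α * (Q y - S.ext y) := by
  obtain ⟨i, hi, hyi⟩ := h.exists_piece h0 hy
  rw [hQ.piece i hi y hyi]
  refine S.best_eq hi (hQ.level_le h hi hyi) fun hi' => ?_
  rw [← hQ.at_knot (i + 1) (by omega)]
  exact (hQ.strictMonoOn hlt h hi').monotoneOn hyi ⟨h.le_succ i hi, le_rfl⟩ hyi.2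

theorem IsPath.end_eq (hQ : S.IsPath α g Q q) (h : S.IsKnots α g) :
    α * (Q S.kHigh - S.ext S.kHigh) = S.best S.pmax := by
  rw [← h.last, hQ.piece S.gap le_rfl _ ⟨h.le_succ _ le_rfl, le_rfl⟩, hQ.at_knot _ le_rfl,
    level_last, best_pmax, ← S.kLow_add_gap]
  push_cast
  ring

theorem IsKnots.rate_le (hlt : S.level S.gap < S.pmax) {α' : ℝ} {g' : ℕ → ℝ}
    (h : S.IsKnots α g) (h' : S.IsKnots α' g') : α ≤ α' := by
  by_contra! hlt'
  have hQ := h.isPath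
  have hQ' := h'.isPath
  set Q := fun y => ∫ s in (0 : ℝ)..y, S.pathPrice α g s
  set Q' := fun y => ∫ s in (0 : ℝ)..y, S.pathPrice α' g' s
  set q := S.pathPrice α g
  set q' := S.pathPrice α' g'
  have hinit : ∀ y ∈ Set.Icc 0 (g 0), S.pmin * y - S.cost y ≤ S.pmin * g 0 - S.cost (g 0) := by
    intro y hy
    rcases hy.2.eq_or_lt with rfl | hy'
    · exact le_rfl
    · exact (surplus_lt_of_not_growsBeyond (hQ.not_growsBeyond_zero hlt h) hy.1 hy'
        (h.mem_Icc (Nat.zero_le _)).2).le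
  have hstart : Q' (g' 0) ≤ Q (g' 0) := by
    rw [hQ'.eq_mul ⟨h'.pos.le, le_rfl⟩]
    have := mul_sub_le_sub_of_le_deriv (m := S.pmin) hQ.deriv h'.pos.le
      fun y hy => hQ.pmin_le h (hy.2.trans (h'.le_kHigh (Nat.zero_le _)))
    rw [hQ.zero] at this
    linarith
  -- The curve with the smaller parameter stays below: at a contact point with `q ≤ q'`,
  -- monotonicity of `best` would give `α * (Q - f) ≤ best q ≤ best q' = α' * (Q - f)`, impossible
  -- for a positive profit. Yet both curves must satisfy the same end condition.
  have hcmp := image_le_of_deriv_right_lt_deriv_boundary (f := Q') (f' := q') (a := g' 0)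
    (b := S.kHigh) (fun y _ => (hQ'.deriv y).continuousAt.continuousWithinAt)
    (fun y _ => (hQ'.deriv y).hasDerivWithinAt) hstart hQ.deriv
    (fun y hy heq => by
      by_contra! hle
      have h1 := hQ.le_best h hinit ⟨h'.pos.le.trans hy.1, hy.2.le⟩
      have h2 := hQ'.best_eq hlt h' hy.1 hy.2.le
      have h3 := S.best_mono hle
      have h4 := S.best_mono (hQ'.pmin_le h' hy.2.le)
      have h5 := S.best_pmin_pos
      rw [heq] at h2
      have h6 : 0 < Q y - S.ext y := by
        by_contra! hneg
        have := h'.rate_pos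
        nlinarith
      nlinarith)
    ⟨h'.le_kHigh (Nat.zero_le _), le_rfl⟩
  have e := hQ.end_eq h
  have e' := hQ'.end_eq h'
  have hpos : 0 < S.best S.pmax := S.best_pmin_pos.trans_le (S.best_mono S.pmin_le_pmax)
  have h6 : 0 < Q' S.kHigh - S.ext S.kHigh := by
    by_contra! hneg
    have := h'.rate_pos
    nlinarith
  nlinarith [h.rate_pos]

theorem IsKnots.not_first_lt (hlt : S.level S.gap < S.pmax) {g' : ℕ → ℝ}
    (h : S.IsKnots α g) (h' : S.IsKnots α g') : ¬ g 0 < g' 0 := fun h0 => by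
  have h1 := surplus_lt_of_not_growsBeyond (h'.isPath.not_growsBeyond_zero hlt h') h.pos.le h0
    (h'.mem_Icc (Nat.zero_le _)).2
  have h2 := h.start.trans h'.start.symm
  have := mul_left_cancel₀ h.rate_pos.ne' h2
  linarith

/-- Equal left ends mean the same price function; it is strictly increasing along `g'`, so it
attains the next level only once. -/
theorem IsKnots.not_succ_lt (hlt : S.level S.gap < S.pmax) {g' : ℕ → ℝ}
    (h : S.IsKnots α g) (h' : S.IsKnots α g') {i : ℕ} (hi : i < S.gap) (he : g i = g' i) :
    ¬ g (i + 1) < g' (i + 1) := fun h0 => by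
  have hQ := h'.isPath
  have h1 : g (i + 1) ∈ Set.Icc (g' i) (g' (i + 1)) := ⟨he ▸ h.le_succ i hi.le, h0.le⟩
  have h2 : g' (i + 1) ∈ Set.Icc (g' i) (g' (i + 1)) := ⟨h'.le_succ i hi.le, le_rfl⟩
  have h3 := hQ.strictMonoOn hlt h' hi h1 h2 h0
  rw [hQ.eq_price i hi.le _ h1, hQ.eq_price i hi.le _ h2, h'.price_eq i hi.le, ← he,
    h.price_eq i hi.le] at h3
  exact lt_irrefl _ h3

theorem IsKnots.unique (hlt : S.level S.gap < S.pmax) {α' : ℝ} {g' : ℕ → ℝ}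
    (h : S.IsKnots α g) (h' : S.IsKnots α' g') {i : ℕ} (hi : i ≤ S.gap + 1) : g i = g' i := by
  obtain rfl : α = α' := le_antisymm (h.rate_le hlt h') (h'.rate_le hlt h)
  induction i with
  | zero => exact le_antisymm (not_lt.1 (h'.not_first_lt hlt h)) (not_lt.1 (h.not_first_lt hlt h'))
  | succ i ih =>
    have ih := ih (by omega)
    rcases Nat.lt_or_ge i S.gap with h1 | h1
    · exact le_antisymm (not_lt.1 (h'.not_succ_lt hlt h h1 ih.symm))
        (not_lt.1 (h.not_succ_lt hlt h' h1 ih))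
    · obtain rfl : i = S.gap := by omega
      rw [h.last, h'.last]

/-! ### Solutions of the system -/

/-- The breakpoints of `γ` as a sequence. -/
def knot (γ : Fin (S.gap + 2) → ℝ) (i : ℕ) : ℝ := γ ⟨min i (S.gap + 1), by omega⟩

theorem knot_val (γ : Fin (S.gap + 2) → ℝ) (i : Fin (S.gap + 2)) : knot γ i = γ i := by
  unfold knot
  congr 1
  ext
  simp only
  omega

theorem knot_zero (γ : Fin (S.gap + 2) → ℝ) : knot γ 0 = γ 0 := knot_val γ 0

theorem IsSolution.isKnots {γ : Fin (S.gap + 2) → ℝ} (h : S.IsSolution γ) :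
    S.IsKnots (S.ratio (γ 0)) (knot γ) := by
  have hmono : Monotone (knot γ) := fun i j hij => h.mono (by
    rw [Fin.mk_le_mk]; omega)
  have hlast : knot γ (S.gap + 1) = S.kHigh := by
    rw [← h.last, ← knot_val γ (Fin.last _), Fin.val_last]
  have hle : ∀ i ≤ S.gap + 1, knot γ i ≤ S.k := fun i hi =>
    (hmono hi).trans (hlast.le.trans (by exact_mod_cast S.kHigh_le_k))
  have hpos : ∀ i, 0 ≤ knot γ i := fun i => (knot_zero γ ▸ h.pos).le.trans (hmono (Nat.zero_le i))
  refine ⟨div_pos S.surplus_kLow_pos h.profit_pos, knot_zero γ ▸ h.pos,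
    fun i _ => hmono (Nat.le_succ i), hlast, ?_, fun i hi => ?_⟩
  · rw [S.threshold_zero, knot_zero]
    unfold ratio
    rw [div_mul_cancel₀ _ h.profit_pos.ne']
  · have he := h.eqn ⟨i, by omega⟩
    rw [← knot_val γ (Fin.succ _), ← knot_val γ (Fin.castSucc _)] at he
    simp only [Fin.val_succ, Fin.val_castSucc] at he
    exact (S.equation_iff _ (S.kLow_add_pos i) (hpos i) (hmono (Nat.le_succ i))
      (hle _ (by omega)) _ _).1 he

theorem IsKnots.isSolution (h : S.IsKnots α g) :
    S.IsSolution fun i : Fin (S.gap + 2) => g i := by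
  have hs := h.start
  rw [S.threshold_zero] at hs
  have hp : 0 < S.pmin * g 0 - S.cost (g 0) := by
    have := S.surplus_kLow_pos
    rw [← hs] at this
    exact (mul_pos_iff_of_pos_left h.rate_pos).1 this
  have hr : S.ratio (g 0) = α := by
    unfold ratio
    rw [← hs, mul_div_cancel_right₀ _ hp.ne']
  refine ⟨h.pos, hp, fun i j hij => h.mono hij (by omega), h.last, fun i => ?_⟩
  simp only [Fin.val_succ, Fin.val_castSucc, Fin.val_zero]
  rw [hr]
  exact (S.equation_iff _ (S.kLow_add_pos i) (h.pos' (by omega)).le (h.le_succ i (by omega))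
    (h.mem_Icc (by omega)).2 _ _).2 (h.price_eq i (by omega))

end Setup

namespace Setup
variable {S : Setup} {α : ℝ} {g : ℕ → ℝ} {Q q : ℝ → ℝ}

/-! ### Comparing a selling schedule with a solution -/

theorem exists_ext_le_line {n : ℕ} (h1 : 1 ≤ n) (hn : n ≤ S.k) {y : ℝ}
    (hy : y ∈ Set.Icc 0 (n : ℝ)) : ∃ i, 1 ≤ i ∧ i ≤ n ∧ S.ext y ≤ S.line i y := by
  obtain ⟨i, hi1, hin, hyi⟩ : ∃ i : ℕ, 1 ≤ i ∧ i ≤ n ∧ y ∈ Set.Icc ((i : ℝ) - 1) i := by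
    rcases hy.1.eq_or_lt with rfl | h0
    · exact ⟨1, le_rfl, h1, by norm_num⟩
    · refine ⟨⌈y⌉₊, Nat.one_le_iff_ne_zero.2 (Nat.ceil_pos.2 h0).ne', Nat.ceil_le.2 hy.2, ?_,
        Nat.le_ceil y⟩
      have := Nat.ceil_lt_add_one hy.1
      linarith
  refine ⟨i, hi1, hin, ?_⟩
  rw [S.ext_eq ⟨hy.1, hy.2.trans (by exact_mod_cast hn)⟩]
  exact S.le_line hi1 (hin.trans hn) hyi

/-- Selling at price at most `p + δ` from `a` to `b` cannot overtake a solution with a larger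
parameter, as long as the profit is competitive at price `p`. -/
theorem IsPath.add_mul_le (hQ : S.IsPath α g Q q) (h : S.IsKnots α g)
    (hinit : ∀ y ∈ Set.Icc 0 (g 0), S.pmin * y - S.cost y ≤ S.pmin * g 0 - S.cost (g 0))
    {β p δ s a b A : ℝ} (hβ : 0 < β) (hp : S.pmin ≤ p) (hβα : β < α) (hδ : 0 ≤ δ) (hs : s ≤ p + δ)
    (hsmall : β * (S.kHigh * δ) < (α - β) * S.best S.pmin) (ha : 0 ≤ a) (hab : a ≤ b)
    (hb : b ≤ S.kHigh) (hA : A ≤ Q a)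
    (hfeas : ∀ y ∈ Set.Icc a b, S.best p ≤ β * (A + s * (y - a) - S.ext y)) :
    A + s * (b - a) ≤ Q b := by
  have hd : ∀ y, HasDerivAt (fun y => A + s * (y - a)) (s * 1) y := fun y =>
    (((hasDerivAt_id y).sub_const a).const_mul s).const_add A
  refine image_le_of_deriv_right_lt_deriv_boundary (f := fun y => A + s * (y - a))
    (f' := fun _ => s * 1) (fun y _ => (hd y).continuousAt.continuousWithinAt)
    (fun y _ => (hd y).hasDerivWithinAt) (by simpa using hA) hQ.deriv (fun y hy heq => ?_)
    (Set.right_mem_Icc.2 hab)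
  -- At a contact point with `q y ≤ s ≤ p + δ`, the path earns at most `best (p + δ) / α` and the
  -- schedule at least `best p / β`; `hsmall` says that the gap between `α` and `β` outweighs the
  -- `δ`.
  by_contra! hle
  have h1 := hfeas y ⟨hy.1, hy.2.le⟩
  rw [heq] at h1
  have h2 := hQ.le_best h hinit ⟨ha.trans hy.1, hy.2.le.trans hb⟩
  have h3 := (S.best_mono (by linarith : q y ≤ p + δ)).trans (S.best_add_le hδ)
  have h4 := S.best_mono hp
  have h5 : α * S.best p ≤ β * (S.best p + S.kHigh * δ) :=
    calc α * S.best p ≤ α * (β * (Q y - S.ext y)) := by have := h.rate_pos; gcongr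
      _ = β * (α * (Q y - S.ext y)) := by ring
      _ ≤ _ := by gcongr; exact h2.trans h3
  have h6 : (α - β) * S.best S.pmin ≤ (α - β) * S.best p := by
    gcongr
  linarith

/-- Expected numbers `ψ` and revenues `u` of units sold along a ladder of prices `p`, with an
expected profit of at least `best (p j) / β` at every step, for the costs bounded below by their
chords. -/
structure IsSchedule (S : Setup) (β : ℝ) (N : ℕ) (p ψ u : ℕ → ℝ) : Prop where
  count_nonneg : 0 ≤ ψ 0
  count_le_succ : ∀ j < N, ψ j ≤ ψ (j + 1)
  count_le : ∀ j ≤ N, ψ j ≤ S.k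
  revenue_zero : u 0 = p 0 * ψ 0
  revenue_succ : ∀ j < N, u (j + 1) = u j + p (j + 1) * (ψ (j + 1) - ψ j)
  best_le : ∀ j ≤ N, ∀ i, 1 ≤ i → i ≤ S.k → S.best (p j) ≤ β * (u j - S.line i (ψ j))

theorem IsSchedule.count_nonneg' {β : ℝ} {N : ℕ} {p ψ u : ℕ → ℝ} (hs : S.IsSchedule β N p ψ u)
    {j : ℕ} (hj : j ≤ N) : 0 ≤ ψ j := by
  induction j with
  | zero => exact hs.count_nonneg
  | succ j ih => exact (ih (by omega)).trans (hs.count_le_succ j (by omega))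

/-- Measured against a fixed chord the profit is affine in `y`, so it is at least its value at one
of the two ends, depending on the sign of `p (j + 1) - marginal i`. The chord is chosen to dominate
the cost at `y`. -/
theorem IsSchedule.feasible_between {β : ℝ} {N : ℕ} {p ψ u : ℕ → ℝ} (hβ : 0 < β)
    (hs : S.IsSchedule β N p ψ u) {j : ℕ} (hj : j < N) (hp : p j ≤ p (j + 1)) {y : ℝ}
    (hy : y ∈ Set.Icc (ψ j) (ψ (j + 1))) :
    S.best (p j) ≤ β * (u j + p (j + 1) * (y - ψ j) - S.ext y) := by
  obtain ⟨i, h1, hi, hle⟩ := exists_ext_le_line (S := S) S.one_le_k le_rfl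
    ⟨(hs.count_nonneg' hj.le).trans hy.1, hy.2.trans (hs.count_le _ hj)⟩
  have ha := hs.best_le j hj.le i h1 hi
  have hb := (S.best_mono hp).trans (hs.best_le (j + 1) hj i h1 hi)
  rw [hs.revenue_succ j hj] at hb
  have hmono : ∀ t, t ≤ u j + p (j + 1) * (y - ψ j) - S.line i y →
      β * t ≤ β * (u j + p (j + 1) * (y - ψ j) - S.ext y) := fun t ht => by
    gcongr
    linarith
  unfold line at ha hb hmono
  rcases le_total (S.marginal i) (p (j + 1)) with hc | hc
  · refine ha.trans (hmono _ ?_)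
    nlinarith [hy.1]
  · refine hb.trans (hmono _ ?_)
    nlinarith [hy.2]

/-- By induction the revenue stays below `Q`, where units beyond `kHigh` are credited at the current
price. At the top the count is moved to `kHigh` without loss: missing units cost at most `pmax`
each, surplus ones at least `pmax`. The outcome contradicts `end_eq`. -/
theorem IsSchedule.false (h : S.IsKnots α g)
    (hinit : ∀ y ∈ Set.Icc 0 (g 0), S.pmin * y - S.cost y ≤ S.pmin * g 0 - S.cost (g 0))
    {β δ : ℝ} {N : ℕ} {p ψ u : ℕ → ℝ} (hβ : 0 < β) (hβα : β < α) (hδ : 0 ≤ δ)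
    (hsmall : β * (S.kHigh * δ) < (α - β) * S.best S.pmin) (hp0 : p 0 = S.pmin)
    (hpN : p N = S.pmax) (hpm : Monotone p) (hpδ : ∀ j, p (j + 1) ≤ p j + δ)
    (hs : S.IsSchedule β N p ψ u) : False := by
  have hQ := h.isPath
  set Q := fun y => ∫ s in (0 : ℝ)..y, S.pathPrice α g s
  set q := S.pathPrice α g
  have hkpos : (0 : ℝ) ≤ S.kHigh := Nat.cast_nonneg _
  have hlow : ∀ y : ℝ, 0 ≤ y → y ≤ S.kHigh → S.pmin * y ≤ Q y := fun y h0 h1 => by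
    have := mul_sub_le_sub_of_le_deriv (m := S.pmin) hQ.deriv h0
      fun z hz => hQ.pmin_le h (hz.2.trans h1)
    rw [hQ.zero] at this
    linarith
  have hpge : ∀ j, S.pmin ≤ p j := fun j => hp0 ▸ hpm (Nat.zero_le j)
  have key : ∀ j ≤ N, (ψ j ≤ S.kHigh → u j ≤ Q (ψ j)) ∧
      (S.kHigh ≤ ψ j → u j ≤ Q S.kHigh + p j * (ψ j - S.kHigh)) := by
    intro j
    induction j with
    | zero =>
      intro _
      rw [hs.revenue_zero, hp0]
      refine ⟨fun hle => hlow _ hs.count_nonneg hle, fun _ => ?_⟩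
      have := hlow _ hkpos le_rfl
      linarith
    | succ j ih =>
      intro hj
      obtain ⟨ih1, ih2⟩ := ih (by omega)
      have hψ := hs.count_le_succ j hj
      have hu := hs.revenue_succ j hj
      rcases le_total (ψ j) S.kHigh with hc | hc
      · have hstep : ∀ b, ψ j ≤ b → b ≤ ψ (j + 1) → b ≤ S.kHigh →
            u j + p (j + 1) * (b - ψ j) ≤ Q b := fun b hb1 hb2 hb3 =>
          hQ.add_mul_le h hinit hβ (hpge j) hβα hδ (hpδ j) hsmall (hs.count_nonneg' (by omega))
            hb1 hb3 (ih1 hc) fun y hy => hs.feasible_between hβ hj (hpm (Nat.le_succ j))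
              ⟨hy.1, hy.2.trans hb2⟩
        refine ⟨fun hle => hu ▸ hstep _ hψ le_rfl hle, fun hge => ?_⟩
        have := hstep _ hc hge le_rfl
        rw [hu]
        linarith
      · have hm := hpm (Nat.le_succ j)
        have := ih2 hc
        have hend : u (j + 1) ≤ Q S.kHigh + p (j + 1) * (ψ (j + 1) - S.kHigh) := by
          rw [hu]
          nlinarith
        refine ⟨fun hle => ?_, fun _ => hend⟩
        rw [le_antisymm hle (hc.trans hψ)] at hend ⊢
        simpa using hend
  have hgam := S.Gam_spec S.pmin_le_pmax
  have hfinal : S.best S.pmax ≤ β * (Q S.kHigh - S.ext S.kHigh) := by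
    rcases le_or_gt (ψ N) S.kHigh with hc | hc
    · have hfeas : ∀ y ∈ Set.Icc (ψ N) (S.kHigh : ℝ),
          S.best S.pmax ≤ β * (u N + S.pmax * (y - ψ N) - S.ext y) := fun y hy => by
        obtain ⟨i, h1, hi, hle⟩ := exists_ext_le_line (S := S)
          (S.one_le_kLow.trans S.kLow_le_kHigh) S.kHigh_le_k
          ⟨(hs.count_nonneg' le_rfl).trans hy.1, hy.2⟩
        have h3 := hs.best_le N le_rfl i h1 (hi.trans S.kHigh_le_k)
        rw [hpN] at h3
        refine h3.trans ?_
        have h4 : S.marginal i ≤ S.pmax :=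
          (S.marginal_mono h1 hi S.kHigh_le_k).trans hgam.2.2.1
        refine mul_le_mul_of_nonneg_left ?_ hβ.le
        unfold line at hle ⊢
        nlinarith [hy.1]
      have h1 := hQ.add_mul_le h hinit hβ S.pmin_le_pmax hβα hδ (s := S.pmax) (by linarith)
        hsmall (hs.count_nonneg' le_rfl) hc le_rfl ((key N le_rfl).1 hc) hfeas
      refine (hfeas _ ⟨hc, le_rfl⟩).trans ?_
      gcongr
    · have hlt : S.kHigh < S.k := by exact_mod_cast hc.trans_le (hs.count_le N le_rfl)
      have h1 := (key N le_rfl).2 hc.le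
      have h2 := hs.best_le N le_rfl (S.kHigh + 1) (by omega) hlt
      have h3 : S.pmax < S.marginal (S.kHigh + 1) := hgam.2.2.2 hlt
      rw [hpN] at h1 h2
      refine h2.trans ?_
      rw [S.line_succ, S.ext_eq (S.natCast_mem S.kHigh_le_k)]
      refine mul_le_mul_of_nonneg_left ?_ hβ.le
      nlinarith
  have he := hQ.end_eq h
  have hpos : 0 < S.best S.pmax := S.best_pmin_pos.trans_le (S.best_mono S.pmin_le_pmax)
  have h6 : 0 < Q S.kHigh - S.ext S.kHigh := by
    by_contra! hneg
    nlinarith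
  nlinarith

/-- Already the first step of a schedule is impossible with a competitive ratio below one. -/
theorem IsSchedule.one_le {β : ℝ} {N : ℕ} {p ψ u : ℕ → ℝ} (hβ : 0 < β) (hp0 : p 0 = S.pmin)
    (hs : S.IsSchedule β N p ψ u) : 1 ≤ β := by
  by_contra! hβ1
  have hg := S.Gam_spec le_rfl
  -- The chord is the one ending or the one starting at `kLow`, according to the side on which `ψ 0`
  -- lies; against it, no count on that side beats `kLow` units at price `pmin`.
  have hX : ∃ i, 1 ≤ i ∧ i ≤ S.k ∧ u 0 - S.line i (ψ 0) ≤ S.best S.pmin := by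
    have hb := S.le_best S.kLow_le_kHigh S.pmin
    rw [hs.revenue_zero, hp0]
    rcases le_or_gt (ψ 0) S.kLow with hc | hc
    · refine ⟨S.kLow, hg.1, hg.2.1, ?_⟩
      have h3 : S.marginal S.kLow ≤ S.pmin := hg.2.2.1
      unfold line
      nlinarith
    · have hlt : S.kLow < S.k := by exact_mod_cast hc.trans_le (hs.count_le 0 (Nat.zero_le _))
      refine ⟨S.kLow + 1, by omega, hlt, ?_⟩
      have h3 : S.pmin < S.marginal (S.kLow + 1) := hg.2.2.2 hlt
      rw [S.line_succ]
      nlinarith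
  obtain ⟨i, h1, hi, hX⟩ := hX
  have h2 := hs.best_le 0 (Nat.zero_le _) i h1 hi
  rw [hp0] at h2
  have h3 := S.best_pmin_pos
  nlinarith

end Setup

/-! ### Online algorithms on price ladders -/

/-- Decisions depend only on the prefix seen so far, so a further buyer leaves earlier selections
unchanged. -/
theorem sum_selected_append (d : List ℝ → Bool) (I : List ℝ) (p : ℝ) (F : ℝ → ℝ) :
    ∑ t ∈ Setup.selected d (I ++ [p]), F ((I ++ [p]).get t)
      = ∑ t ∈ Setup.selected d I, F (I.get t) + if d (I ++ [p]) = true then F p else 0 := by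
  unfold Setup.selected
  rw [Finset.sum_filter, Finset.sum_filter]
  have hlen : (I ++ [p]).length = I.length + 1 := by simp
  rw [← (finCongr hlen.symm).sum_comp, Fin.sum_univ_castSucc]
  congr 1
  · refine Finset.sum_congr rfl fun t _ => ?_
    have ht : t.val + 1 ≤ I.length := t.isLt
    simp [List.take_append_of_le_length ht]
  · simp [List.take_of_length_le]

/-- The number of buyers selected, as a real number. -/
def count (d : List ℝ → Bool) (I : List ℝ) : ℝ := ∑ _t ∈ Setup.selected d I, (1 : ℝ)

/-- The sum of the accepted prices. -/
def revenue (d : List ℝ → Bool) (I : List ℝ) : ℝ := ∑ t ∈ Setup.selected d I, I.get t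

theorem count_eq_card (d : List ℝ → Bool) (I : List ℝ) :
    count d I = (Setup.selected d I).card := by
  simp [count]

theorem count_append (d : List ℝ → Bool) (I : List ℝ) (p : ℝ) :
    count d (I ++ [p]) = count d I + if d (I ++ [p]) = true then 1 else 0 :=
  sum_selected_append d I p fun _ => 1

theorem revenue_append (d : List ℝ → Bool) (I : List ℝ) (p : ℝ) :
    revenue d (I ++ [p]) = revenue d I + if d (I ++ [p]) = true then p else 0 :=
  sum_selected_append d I p id

theorem append_replicate (d : List ℝ → Bool) (I : List ℝ) (p : ℝ) (m : ℕ) :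
    count d I ≤ count d (I ++ List.replicate m p) ∧
      revenue d (I ++ List.replicate m p)
        = revenue d I + p * (count d (I ++ List.replicate m p) - count d I) := by
  induction m with
  | zero => simp
  | succ m ih =>
    rw [List.replicate_succ', ← List.append_assoc, count_append, revenue_append, ih.2]
    split_ifs
    · exact ⟨by linarith [ih.1], by ring⟩
    · exact ⟨by linarith [ih.1], by ring⟩

theorem count_nil (d : List ℝ → Bool) : count d [] = 0 := by simp [count, Setup.selected]

theorem revenue_nil (d : List ℝ → Bool) : revenue d [] = 0 := by simp [revenue, Setup.selected]

/-- `m` buyers at each of the prices `p 0, …, p j`. -/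
def ladder (m : ℕ) (p : ℕ → ℝ) : ℕ → List ℝ
  | 0 => List.replicate m (p 0)
  | j + 1 => ladder m p j ++ List.replicate m (p (j + 1))

theorem ladder_eq (m : ℕ) (p : ℕ → ℝ) (j : ℕ) :
    ∃ I, ladder m p j = I ++ List.replicate m (p j) := by
  cases j with
  | zero => exact ⟨[], rfl⟩
  | succ j => exact ⟨_, rfl⟩

theorem exists_of_mem_ladder {m : ℕ} {p : ℕ → ℝ} {j : ℕ} {x : ℝ} (hx : x ∈ ladder m p j) :
    ∃ i ≤ j, x = p i := by
  induction j with
  | zero => exact ⟨0, le_rfl, List.eq_of_mem_replicate hx⟩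
  | succ j ih =>
    rcases List.mem_append.1 hx with h | h
    · obtain ⟨i, hi, rfl⟩ := ih h
      exact ⟨i, by omega, rfl⟩
    · exact ⟨j + 1, le_rfl, List.eq_of_mem_replicate h⟩

namespace Setup
variable {S : Setup}

theorem surplus_le_opt (S : Setup) (I : List ℝ) (p : ℝ) {n : ℕ} (hn : n ≤ S.k) :
    n * p - S.cost n ≤ S.opt (I ++ List.replicate S.k p) := by
  set J := I ++ List.replicate S.k p
  let e : Fin n ↪ Fin J.length :=
    ⟨fun a => ⟨I.length + a, by have := a.isLt; simp [J]; omega⟩, fun a b hab => by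
      simpa [Fin.ext_iff] using hab⟩
  have hcard : (Finset.univ.map e).card = n := by simp
  have hX : Finset.univ.map e ∈
      (Finset.univ : Finset (Finset (Fin J.length))).filter (fun X => X.card ≤ S.k) := by
    simp [hn]
  have := Finset.le_sup' (fun X : Finset (Fin J.length) =>
    ∑ t ∈ X, J.get t - S.cost (X.card : ℝ)) hX
  refine le_trans ?_ this
  simp only [hcard, Finset.sum_map]
  have hget : ∀ a : Fin n, J.get (e a) = p := fun a => by
    change (I ++ List.replicate S.k p).get ⟨I.length + a.val, _⟩ = p
    rw [List.get_eq_getElem, List.getElem_append_right (Nat.le_add_right _ _)]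
    simp
  simp only [hget]
  simp

theorem best_le_opt (S : Setup) (p : ℕ → ℝ) (j : ℕ) :
    S.best (p j) ≤ S.opt (ladder S.k p j) := by
  obtain ⟨I, hI⟩ := ladder_eq S.k p j
  rw [hI]
  exact S.best_le fun n hn => S.surplus_le_opt I (p j) (hn.trans S.kHigh_le_k)

variable {Ω : Type*} [MeasurableSpace Ω] {μ : Measure Ω} [IsProbabilityMeasure μ]

theorem Algorithm.integrable_sum (A : S.Algorithm Ω) (I : List ℝ) (F : Fin I.length → ℝ) :
    Integrable (fun ω => ∑ t ∈ selected (A.decide ω) I, F t) μ := by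
  unfold selected
  simp only [Finset.sum_filter]
  refine integrable_finsetSum _ fun t _ => ?_
  have hs : MeasurableSet {ω | A.decide ω (I.take (t.val + 1)) = true} :=
    A.measurable_decide _ (measurableSet_singleton true)
  refine ((integrable_const (μ := μ) (F t)).indicator hs).congr
    (Filter.Eventually.of_forall fun ω => ?_)
  simp [Set.indicator]

theorem Algorithm.integrable_count (A : S.Algorithm Ω) (I : List ℝ) :
    Integrable (fun ω => count (A.decide ω) I) μ := A.integrable_sum I fun _ => 1

theorem Algorithm.integrable_revenue (A : S.Algorithm Ω) (I : List ℝ) :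
    Integrable (fun ω => revenue (A.decide ω) I) μ := A.integrable_sum I I.get

theorem Algorithm.measurable_card (A : S.Algorithm Ω) (I : List ℝ) :
    Measurable fun ω => (selected (A.decide ω) I).card := by
  unfold selected
  simp only [Finset.card_filter]
  refine Finset.measurable_sum _ fun t _ => ?_
  exact Measurable.ite (A.measurable_decide _ (measurableSet_singleton true)) measurable_const
    measurable_const

theorem Algorithm.integrable_cost (A : S.Algorithm Ω) (I : List ℝ) (hI : S.IsInstance I) :
    Integrable (fun ω => S.cost ((selected (A.decide ω) I).card : ℝ)) μ := by
  refine Integrable.of_bound (C := S.cost S.k)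
    ((measurable_of_countable fun n : ℕ => S.cost (n : ℝ)).comp
      (A.measurable_card I)).aestronglyMeasurable (Filter.Eventually.of_forall fun ω => ?_)
  have hm := S.natCast_mem (A.capacity ω I hI)
  rw [Real.norm_of_nonneg (S.cost_nonneg hm)]
  exact S.monotone_cost hm (S.natCast_mem le_rfl) hm.2

/-- A chord lies below the cost at all integers and is affine, so it commutes with the expectation.
-/
theorem Algorithm.integral_profit_le (A : S.Algorithm Ω) (I : List ℝ) (hI : S.IsInstance I)
    {i : ℕ} (h1 : 1 ≤ i) (hi : i ≤ S.k) :
    ∫ ω, S.profit (A.decide ω) I ∂μ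
      ≤ ∫ ω, revenue (A.decide ω) I ∂μ - S.line i (∫ ω, count (A.decide ω) I ∂μ) := by
  have hc := A.integrable_count (μ := μ) I
  have hr := A.integrable_revenue (μ := μ) I
  have hci : Integrable (fun ω => S.marginal i * (count (A.decide ω) I - i)) μ :=
    (hc.sub (integrable_const _)).const_mul _
  have hline : S.line i (∫ ω, count (A.decide ω) I ∂μ)
      = ∫ ω, S.line i (count (A.decide ω) I) ∂μ := by
    unfold line
    rw [integral_add (integrable_const _) hci, integral_const_mul,
      integral_sub hc (integrable_const _)]
    simp
  have hli : Integrable (fun ω => S.line i (count (A.decide ω) I)) μ :=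
    (integrable_const _).add hci
  rw [hline, ← integral_sub hr hli]
  refine integral_mono (hr.sub (A.integrable_cost I hI)) (hr.sub hli) fun ω => ?_
  have := S.line_natCast_le h1 hi (A.capacity ω I hI)
  rw [← count_eq_card] at this
  simp only [profit, revenue] at *
  rw [← count_eq_card]
  linarith

/-- A competitive algorithm yields a schedule along every ladder of prices. -/
theorem IsCompetitive.isSchedule {A : S.Algorithm Ω} {β : ℝ} (hA : S.IsCompetitive A μ β)
    (N : ℕ) {p : ℕ → ℝ} (hp : ∀ j ≤ N, p j ∈ Set.Icc S.pmin S.pmax) :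
    S.IsSchedule β N p (fun j => ∫ ω, count (A.decide ω) (ladder S.k p j) ∂μ)
      (fun j => ∫ ω, revenue (A.decide ω) (ladder S.k p j) ∂μ) := by
  have hinst : ∀ j ≤ N, S.IsInstance (ladder S.k p j) := fun j hj x hx => by
    obtain ⟨i, hi, rfl⟩ := exists_of_mem_ladder hx
    exact hp i (hi.trans hj)
  have hc := fun j => A.integrable_count (μ := μ) (ladder S.k p j)
  refine ⟨?_, fun j _ => ?_, fun j hj => ?_, ?_, fun j _ => ?_, fun j hj i h1 hi => ?_⟩
  · refine integral_nonneg fun ω => ?_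
    simp only [count_eq_card]
    positivity
  · exact integral_mono (hc j) (hc (j + 1)) fun ω => (append_replicate _ _ _ _).1
  · have := integral_mono (hc j) (integrable_const (S.k : ℝ)) fun ω => by
      simp only [count_eq_card]
      exact_mod_cast A.capacity ω _ (hinst j hj)
    simpa using this
  · rw [← integral_const_mul]
    congr 1
    ext ω
    have := (append_replicate (A.decide ω) [] (p 0) S.k).2
    simpa [revenue_nil, count_nil, ladder] using this
  · have hi : Integrable (fun ω => p (j + 1) * (count (A.decide ω) (ladder S.k p (j + 1))
        - count (A.decide ω) (ladder S.k p j))) μ := ((hc (j + 1)).sub (hc j)).const_mul _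
    rw [← integral_sub (hc (j + 1)) (hc j), ← integral_const_mul,
      ← integral_add (A.integrable_revenue _) hi]
    congr 1
    ext ω
    exact (append_replicate (A.decide ω) (ladder S.k p j) (p (j + 1)) S.k).2
  · have h2 := (hA.2 _ (hinst j hj)).trans (A.integral_profit_le _ (hinst j hj) h1 hi)
    rw [div_le_iff₀ hA.1] at h2
    have := S.best_le_opt p j
    linarith

/-- No online algorithm beats the parameter of a solution. -/
theorem IsKnots.not_isCompetitive {α : ℝ} {g : ℕ → ℝ} (h : S.IsKnots α g) (A : S.Algorithm Ω)
    {β : ℝ} (hβα : β < α) : ¬ S.IsCompetitive A μ β := by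
  intro hA
  have hβ := hA.1
  have hw : 0 ≤ S.pmax - S.pmin := sub_nonneg.2 S.pmin_le_pmax
  -- A one-step ladder at `pmin` already forces `β ≥ 1`, hence `α > 1`; this is what puts `g 0` at
  -- or below `kLow`.
  have hβ1 : 1 ≤ β := (hA.isSchedule 0 (p := fun _ => S.pmin)
    fun _ _ => ⟨le_rfl, S.pmin_le_pmax⟩).one_le hβ rfl
  have hg0 := h.le_kLow (hβ1.trans hβα.le)
  -- Since `α > 1`, the surplus at `g 0` is strictly below that at `kLow`; a larger surplus at some
  -- `y < g 0` would then violate concavity.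
  have hinit : ∀ y ∈ Set.Icc 0 (g 0), S.pmin * y - S.cost y ≤ S.pmin * g 0 - S.cost (g 0) := by
    intro y hy
    by_contra! hlt
    have hst := h.start
    have hpos := S.surplus_kLow_pos
    rw [S.threshold_zero] at hst
    have hlt2 : S.pmin * g 0 - S.cost (g 0) < S.pmin * S.kLow - S.cost S.kLow := by
      have : 0 < S.pmin * g 0 - S.cost (g 0) := by
        rw [← hst] at hpos
        exact (mul_pos_iff_of_pos_left h.rate_pos).1 hpos
      nlinarith
    have hy0 : y < g 0 := lt_of_le_of_ne hy.2 (by rintro rfl; exact lt_irrefl _ hlt)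
    have hg1 : g 0 < S.kLow := lt_of_le_of_ne hg0 fun he => by
      rw [he] at hlt2
      exact lt_irrefl _ hlt2
    have hk := h.mem_Icc (Nat.zero_le _)
    have hs := S.convex_cost.slope_mono_adjacent ⟨hy.1, hy.2.trans hk.2⟩
      (S.natCast_mem (S.kLow_le_kHigh.trans S.kHigh_le_k)) hy0 hg1
    have h1 : (S.cost S.kLow - S.cost (g 0)) / (S.kLow - g 0) < S.pmin := by
      rw [div_lt_iff₀ (sub_pos.2 hg1)]; linarith
    have h2 : S.pmin < (S.cost (g 0) - S.cost y) / (g 0 - y) := by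
      rw [lt_div_iff₀ (sub_pos.2 hy0)]; linarith
    linarith
  have hm : 0 < (α - β) * S.best S.pmin := mul_pos (sub_pos.2 hβα) S.best_pmin_pos
  -- `N` makes the ladder step `δ = (pmax - pmin) / (N + 1)` small enough for `hsmall`; dividing by
  -- `N + 1` avoids a zero denominator.
  obtain ⟨N, hN⟩ := exists_nat_gt (β * (S.kHigh * (S.pmax - S.pmin)) / ((α - β) * S.best S.pmin))
  rw [div_lt_iff₀ hm] at hN
  have hN0 : (0 : ℝ) < N + 1 := by positivity
  set δ := (S.pmax - S.pmin) / (N + 1) with hδ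
  have hδ0 : 0 ≤ δ := div_nonneg hw hN0.le
  have hδN : δ * (N + 1) = S.pmax - S.pmin := div_mul_cancel₀ _ hN0.ne'
  refine IsSchedule.false (N := N + 1) (p := fun j => S.pmin + j * δ) h hinit hβ hβα hδ0 ?_
    (by simp) (by push_cast; linarith) (fun i j hij => ?_) (fun j => ?_)
    (hA.isSchedule (N + 1) fun j hj => ⟨?_, ?_⟩)
  · rw [hδ, mul_div_assoc', mul_div_assoc', div_lt_iff₀ hN0]
    linarith
  · have : (i : ℝ) ≤ j := by exact_mod_cast hij
    simp only
    gcongr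
  · push_cast
    linarith
  · have : 0 ≤ j * δ := by positivity
    linarith
  · have : (j : ℝ) ≤ N + 1 := by exact_mod_cast hj
    have : j * δ ≤ (N + 1) * δ := by gcongr
    linarith

end Setup

/-! ### Existence of solutions -/

open scoped NNReal in
/-- Global existence for `Q' = φ (α * (Q - f))`, `Q 0 = 0`, with `φ` bounded and Lipschitz. -/
theorem exists_curve {φ f : ℝ → ℝ} (hφ : LipschitzWith 1 φ) {B : ℝ} (hB : ∀ z, |φ z| ≤ B)
    (hf : Continuous f) {α T : ℝ} (hα : 0 ≤ α) (hT : 0 ≤ T) :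
    ∃ Q q : ℝ → ℝ, Continuous q ∧ (∀ y, HasDerivAt Q (q y) y) ∧ Q 0 = 0 ∧
      ∀ y ∈ Set.Icc 0 T, q y = φ (α * (Q y - f y)) := by
  have hB0 : 0 ≤ B := (abs_nonneg _).trans (hB 0)
  -- A ball of radius `B * T` cannot be left within time `T` at speed at most `B`, so the local
  -- theorem covers all of `[0, T]`.
  have hpl : IsPicardLindelof (fun t x => φ (α * (x - f t)))
      (⟨0, Set.left_mem_Icc.2 hT⟩ : Set.Icc (0 : ℝ) T) (0 : ℝ)
      (⟨B * T, by positivity⟩ : ℝ≥0) 0 (⟨B, hB0⟩ : ℝ≥0) (⟨α, hα⟩ : ℝ≥0) := by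
    refine ⟨fun t _ => LipschitzWith.lipschitzOnWith ?_, fun x _ => ?_, fun t _ x _ => hB _, ?_⟩
    · refine LipschitzWith.of_dist_le_mul fun x y => ?_
      refine (hφ.dist_le_mul _ _).trans ?_
      rw [Real.dist_eq, Real.dist_eq, ← mul_sub, sub_sub_sub_cancel_right, abs_mul,
        abs_of_nonneg hα, NNReal.coe_one, one_mul]
      exact le_refl (α * |x - y|)
    · exact (hφ.continuous.comp (by fun_prop)).continuousOn
    · simp only [sub_zero, NNReal.coe_zero, max_eq_left hT]
      exact le_rfl
  obtain ⟨Q, hQ0, hQ⟩ := hpl.exists_eq_forall_mem_Icc_hasDerivWithinAt₀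
  have hQc : ContinuousOn Q (Set.Icc 0 T) := fun y hy => (hQ y hy).continuousWithinAt
  have hclamp : ∀ y : ℝ, max 0 (min y T) ∈ Set.Icc 0 T := fun y =>
    ⟨le_max_left _ _, max_le hT (min_le_right _ _)⟩
  have hclamp_eq : ∀ y ∈ Set.Icc 0 T, max 0 (min y T) = y := fun y hy => by
    rw [min_eq_left hy.2, max_eq_right hy.1]
  -- The solution is replaced by the integral of its slope, clamped outside `[0, T]`, so that the
  -- derivative is two-sided on the whole line.
  set q : ℝ → ℝ := fun y => φ (α * (Q (max 0 (min y T)) - f (max 0 (min y T))))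
  have hqc : Continuous q := by
    refine hφ.continuous.comp (continuous_const.mul (Continuous.sub ?_ ?_))
    · exact hQc.comp_continuous (by fun_prop) hclamp
    · exact hf.comp (by fun_prop)
  have hd : ∀ y, HasDerivAt (fun y => ∫ s in (0 : ℝ)..y, q s) (q y) y := fun y =>
    (hqc.integral_hasStrictDerivAt 0 y).hasDerivAt
  have heq : ∀ y ∈ Set.Icc 0 T, ∫ s in (0 : ℝ)..y, q s = Q y := fun y hy => by
    have := constant_of_has_deriv_right_zero (a := 0) (b := T)
      (f := fun y => (∫ s in (0 : ℝ)..y, q s) - Q y)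
      (fun x hx => (hd x).continuousAt.continuousWithinAt.sub (hQc x hx))
      (fun x hx => by
        have hx' : x ∈ Set.Icc 0 T := ⟨hx.1, hx.2.le⟩
        have h1 : HasDerivWithinAt Q (q x) (Set.Ici x) x := by
          have h2 : HasDerivWithinAt Q _ (Set.Ici x) x := (hQ x hx').mono_of_mem_nhdsWithin
            (Filter.mem_of_superset (Icc_mem_nhdsGE hx.2) (Set.Icc_subset_Icc_left hx.1))
          simpa only [q, hclamp_eq x hx'] using h2
        have := (hd x).hasDerivWithinAt.sub h1
        rwa [sub_self] at this) y hy
    simp only [intervalIntegral.integral_same, hQ0] at this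
    linarith
  refine ⟨_, q, hqc, hd, intervalIntegral.integral_same, fun y hy => ?_⟩
  rw [heq y hy]
  simp only [q, hclamp_eq y hy]

/-- Two curves with different parameters stay close. -/
theorem dist_curve_le {φ f : ℝ → ℝ} (hφ : LipschitzWith 1 φ) {α α' T C : ℝ} (hα : 0 ≤ α)
    (hT : 0 ≤ T) {Q q Q' q' : ℝ → ℝ} (hd : ∀ y, HasDerivAt Q (q y) y)
    (hd' : ∀ y, HasDerivAt Q' (q' y) y) (h0 : Q 0 = 0) (h0' : Q' 0 = 0)
    (hq : ∀ y ∈ Set.Icc 0 T, q y = φ (α * (Q y - f y)))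
    (hq' : ∀ y ∈ Set.Icc 0 T, q' y = φ (α' * (Q' y - f y)))
    (hC : ∀ y ∈ Set.Icc 0 T, |Q' y - f y| ≤ C) :
    dist (Q T) (Q' T) ≤ gronwallBound 0 α (|α' - α| * C) T := by
  have := dist_le_of_approx_trajectories_ODE (v := fun t x => φ (α * (x - f t)))
    (K := ⟨α, hα⟩) (f := Q) (g := Q') (f' := q) (g' := q') (a := 0) (b := T) (εf := 0)
    (εg := |α' - α| * C) (δ := 0)
    (fun t => LipschitzWith.of_dist_le_mul fun x y => by
      refine (hφ.dist_le_mul _ _).trans ?_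
      rw [Real.dist_eq, Real.dist_eq, ← mul_sub, sub_sub_sub_cancel_right, abs_mul,
        abs_of_nonneg hα, NNReal.coe_one, one_mul]
      exact le_refl (α * |x - y|))
    (fun y _ => (hd y).continuousAt.continuousWithinAt) (fun y _ => (hd y).hasDerivWithinAt)
    (fun y hy => by rw [hq y ⟨hy.1, hy.2.le⟩, dist_self])
    (fun y _ => (hd' y).continuousAt.continuousWithinAt) (fun y _ => (hd' y).hasDerivWithinAt)
    (fun y hy => by
      rw [hq' y ⟨hy.1, hy.2.le⟩]
      refine (hφ.dist_le_mul _ _).trans ?_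
      rw [Real.dist_eq, ← sub_mul, abs_mul, NNReal.coe_one, one_mul]
      have := hC y ⟨hy.1, hy.2.le⟩
      gcongr)
    (by rw [h0, h0', dist_self]) T (Set.right_mem_Icc.2 hT)
  rw [zero_add, sub_zero] at this
  exact this

/-! ### Inverting the optimum, and shooting in the parameter -/

namespace Setup
variable (S : Setup)

/-- The price at which the offline optimum is `z`, and `pmin` below the optimum at `pmin`. -/
def priceOf (z : ℝ) : ℝ :=
  max S.pmin ((Finset.Icc S.kLow S.kHigh).inf' (Finset.nonempty_Icc.2 S.kLow_le_kHigh)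
    fun i : ℕ => (z + S.cost i) / i)

theorem priceOf_le_iff {z m : ℝ} : S.priceOf z ≤ m ↔
    S.pmin ≤ m ∧ ∃ i, S.kLow ≤ i ∧ i ≤ S.kHigh ∧ (z + S.cost i) / i ≤ m := by
  simp [priceOf, Finset.inf'_le_iff, and_assoc]

theorem le_priceOf_iff {z m : ℝ} : m ≤ S.priceOf z ↔
    m ≤ S.pmin ∨ ∀ i, S.kLow ≤ i → i ≤ S.kHigh → m ≤ (z + S.cost i) / i := by
  simp [priceOf]

theorem pmin_le_priceOf (z : ℝ) : S.pmin ≤ S.priceOf z := le_max_left _ _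

/-- Each branch has slope `1 / i ≤ 1`. -/
theorem lipschitzWith_priceOf : LipschitzWith 1 S.priceOf := by
  refine LipschitzWith.of_le_add fun z z' => ?_
  obtain ⟨h1, i, hi, hi', hle⟩ := S.priceOf_le_iff.1 (le_refl (S.priceOf z'))
  refine S.priceOf_le_iff.2 ⟨h1.trans (le_add_of_nonneg_right dist_nonneg), i, hi, hi', ?_⟩
  have h1i : (1 : ℝ) ≤ i := by exact_mod_cast S.one_le_kLow.trans hi
  rw [div_le_iff₀ (by linarith)] at hle ⊢
  have h2 : z - z' ≤ dist z z' := le_abs_self _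
  have h3 : 0 ≤ dist z z' := dist_nonneg
  nlinarith

theorem priceOf_mono : Monotone S.priceOf := fun z z' hz => by
  obtain ⟨h1, i, hi, hi', hle⟩ := S.priceOf_le_iff.1 (le_refl (S.priceOf z'))
  exact S.priceOf_le_iff.2 ⟨h1, i, hi, hi', le_trans (by gcongr) hle⟩

theorem div_le_priceOf {z : ℝ} (hz : 0 ≤ z) : z / S.kHigh ≤ S.priceOf z := by
  refine S.le_priceOf_iff.2 (Or.inr fun i hi hi' => ?_)
  have h1i : (1 : ℝ) ≤ i := by exact_mod_cast S.one_le_kLow.trans hi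
  have h2 : (i : ℝ) ≤ S.kHigh := by exact_mod_cast hi'
  have := S.cost_nonneg (S.natCast_mem (hi'.trans S.kHigh_le_k))
  gcongr
  linarith

theorem priceOf_eq_pmin {z : ℝ} (hz : z ≤ S.threshold 0) : S.priceOf z = S.pmin := by
  refine le_antisymm (S.priceOf_le_iff.2 ⟨le_rfl, S.kLow, le_rfl, S.kLow_le_kHigh, ?_⟩)
    (S.pmin_le_priceOf z)
  have h1i : (1 : ℝ) ≤ S.kLow := by exact_mod_cast S.one_le_kLow
  rw [threshold_zero] at hz
  rw [div_le_iff₀ (by linarith)]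
  linarith

/-- Between consecutive thresholds the candidate price lies between the corresponding levels, where
`kLow + i` units are optimal; hence no other branch gives a lower price. -/
theorem priceOf_eq {i : ℕ} (hi : i ≤ S.gap) {z : ℝ} (h1 : S.threshold i ≤ z)
    (h2 : i < S.gap → z ≤ S.threshold (i + 1)) :
    S.priceOf z = (z + S.cost (S.kLow + i)) / (S.kLow + i) := by
  have hK := S.kLow_add_pos i
  set p := (z + S.cost (S.kLow + i)) / (S.kLow + i) with hp
  have hpz : (S.kLow + i) * p = z + S.cost (S.kLow + i) := mul_div_cancel₀ _ hK.ne'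
  have hl : S.level i ≤ p := by
    rw [hp, le_div_iff₀ hK]
    unfold threshold at h1
    linarith
  have hu : i < S.gap → p ≤ S.level (i + 1) := fun hi' => by
    have := h2 hi'
    rw [← S.threshold_succ hi'] at this
    rw [hp, div_le_iff₀ hK]
    linarith
  refine le_antisymm (S.priceOf_le_iff.2 ⟨(S.pmin_le_level (by omega)).trans hl, S.kLow + i,
    by omega, S.kLow_add_le hi, by push_cast; exact le_rfl⟩)
    (S.le_priceOf_iff.2 (Or.inr fun n hn hn' => ?_))
  have h3 := S.surplus_le hi hn' hl hu
  have h1n : (1 : ℝ) ≤ n := by exact_mod_cast S.one_le_kLow.trans hn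
  push_cast at h3
  rw [le_div_iff₀ (by linarith)]
  linarith

theorem ext_zero : S.ext 0 = 0 := by
  rw [S.ext_eq ⟨le_rfl, Nat.cast_nonneg _⟩, S.cost_zero]

/-- A long curve for the truncated price function with a large parameter earns a lot. -/
theorem le_mul_of_curve {A B θ : ℝ} {Q q : ℝ → ℝ} (hB : S.pmin ≤ B)
    (hB' : A * ((S.pmin - S.cost 1) / 2) / S.kHigh ≤ B)
    (hA : 2 * S.kHigh * (S.ext S.kHigh + 1) / ((S.pmin - S.cost 1) / 2) ≤ A) (hAθ : θ ≤ A)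
    (hd : ∀ y, HasDerivAt Q (q y) y) (h0 : Q 0 = 0)
    (hq : ∀ y ∈ Set.Icc 0 (S.kHigh : ℝ), q y = min (S.priceOf (A * (Q y - S.ext y))) B) :
    θ ≤ A * (Q S.kHigh - S.ext S.kHigh) := by
  set w := (S.pmin - S.cost 1) / 2 with hw
  have hw0 : 0 < w := by have := S.cost_one_lt_pmin; simp only [hw]; linarith
  have hk1 : (1 : ℝ) ≤ S.kHigh := by exact_mod_cast S.one_le_kLow.trans S.kLow_le_kHigh
  have hf0 := S.ext_nonneg S.kHigh
  have hA0 : 0 ≤ A := le_trans (by positivity) hA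
  have hqp : ∀ y ∈ Set.Icc 0 (S.kHigh : ℝ), S.pmin ≤ q y := fun y hy => by
    rw [hq y hy]
    exact le_min (S.pmin_le_priceOf _) hB
  -- Revenue is at least `pmin * y` and the cost at most `cost 1 * y` on `[0, 1]`. So the profit is
  -- at least `w` on `[1/2, 1]`, the slope there at least `A * w / kHigh`, and this half interval
  -- alone earns `ext kHigh + 1`.
  have hW : ∀ y ∈ Set.Icc (1 / 2 : ℝ) 1, w ≤ Q y - S.ext y := fun y hy => by
    have h1 := mul_sub_le_sub_of_le_deriv hd (by linarith [hy.1] : (0 : ℝ) ≤ y)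
      fun z hz => hqp z ⟨hz.1, hz.2.trans (hy.2.trans hk1)⟩
    have h2 := S.le_line le_rfl S.one_le_k (y := y) ⟨by norm_num; linarith [hy.1],
      by simpa using hy.2⟩
    rw [← S.ext_eq ⟨by linarith [hy.1], hy.2.trans (by exact_mod_cast S.one_le_k)⟩] at h2
    unfold line marginal at h2
    simp only [Nat.cast_one, sub_self, S.cost_zero, sub_zero] at h2
    rw [h0] at h1
    have := S.cost_one_lt_pmin
    nlinarith [hy.1]
  have hR : ∀ y ∈ Set.Icc (1 / 2 : ℝ) 1, A * w / S.kHigh ≤ q y := fun y hy => by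
    rw [hq y ⟨by linarith [hy.1], hy.2.trans hk1⟩]
    refine le_min ((S.div_le_priceOf (by positivity)).trans (S.priceOf_mono ?_)) hB'
    have := hW y hy
    gcongr
  have h1 := mul_sub_le_sub_of_le_deriv hd (by norm_num : (1 / 2 : ℝ) ≤ 1) hR
  have h2 := mul_sub_le_sub_of_le_deriv hd (by norm_num : (0 : ℝ) ≤ 1 / 2) (m := 0)
    fun z hz => S.pmin_pos.le.trans (hqp z ⟨hz.1, by linarith [hz.2]⟩)
  have h3 := mul_sub_le_sub_of_le_deriv hd hk1 (m := 0)
    fun z hz => S.pmin_pos.le.trans (hqp z ⟨by linarith [hz.1], hz.2⟩)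
  rw [div_le_iff₀ hw0] at hA
  have h4 : 2 * (S.ext S.kHigh + 1) ≤ A * w / S.kHigh := by
    rw [le_div_iff₀ (by linarith)]
    linarith
  nlinarith

/-- The final value of `α * (Q - f)` depends continuously on `α` by Grönwall; it is `0` at `α = 0`
and at least `best pmax` for a large `α`, so some parameter in between hits `best pmax`. -/
theorem exists_rate : ∃ (α : ℝ) (Q q : ℝ → ℝ), 0 < α ∧ (∀ y, HasDerivAt Q (q y) y) ∧ Q 0 = 0 ∧
    (∀ y ∈ Set.Icc 0 (S.kHigh : ℝ), q y = S.priceOf (α * (Q y - S.ext y))) ∧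
    α * (Q S.kHigh - S.ext S.kHigh) = S.best S.pmax := by
  set T : ℝ := (S.kHigh : ℝ)
  set θ := S.best S.pmax
  set w := (S.pmin - S.cost 1) / 2 with hw
  have hT0 : 0 ≤ T := Nat.cast_nonneg _
  have hw0 : 0 < w := by have := S.cost_one_lt_pmin; simp only [hw]; linarith
  have hθ : 0 < θ := S.best_pmin_pos.trans_le (S.best_mono S.pmin_le_pmax)
  have hfT := S.ext_nonneg T
  have hp := S.pmin_pos
  set A := θ + 2 * T * (S.ext T + 1) / w
  have hA2 : 0 ≤ 2 * T * (S.ext T + 1) / w := by positivity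
  have hA0 : 0 < A := by positivity
  have hP : 0 < S.priceOf (θ + A * S.ext T) := hp.trans_le (S.pmin_le_priceOf _)
  -- The truncation gives the bounded slope needed for existence. The second summand leaves room for
  -- `le_mul_of_curve`; the third makes the truncation inactive at the chosen `α`, where `α * (Q -
  -- f) ≤ θ + A * ext T` throughout.
  set B := S.pmin + A * w / T + S.priceOf (θ + A * S.ext T)
  have hAw : 0 ≤ A * w / T := by positivity
  have hB0 : 0 ≤ B := by positivity
  have hφ : LipschitzWith 1 fun z => min (S.priceOf z) B := S.lipschitzWith_priceOf.min_const B
  have hφ0 : ∀ z, 0 ≤ min (S.priceOf z) B := fun z =>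
    le_min (hp.le.trans (S.pmin_le_priceOf z)) hB0
  have hφB : ∀ z, |min (S.priceOf z) B| ≤ B := fun z => by
    rw [abs_of_nonneg (hφ0 z)]
    exact min_le_right _ _
  have hex := fun α : Set.Icc (0 : ℝ) A => exists_curve hφ hφB S.continuous_ext α.2.1 hT0
  choose Q q hqc hd h0 hq using hex
  obtain ⟨F, hF⟩ := isCompact_Icc.exists_bound_of_continuousOn
    (S.continuous_ext.continuousOn (s := Set.Icc 0 T))
  have hC : ∀ α, ∀ y ∈ Set.Icc 0 T, |Q α y - S.ext y| ≤ B * T + F := fun α y hy => by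
    have h1 := mul_sub_le_sub_of_le_deriv (hd α) hy.1 (m := 0) fun z hz => by
      rw [hq α z ⟨hz.1, hz.2.trans hy.2⟩]; exact hφ0 _
    have h2 := mul_sub_le_sub_of_le_deriv (Q := fun y => -Q α y) (fun y => (hd α y).neg) hy.1
      (m := -B) fun z hz => by
        rw [hq α z ⟨hz.1, hz.2.trans hy.2⟩]; exact neg_le_neg (min_le_right _ _)
    have h3 := hF y hy
    rw [Real.norm_eq_abs] at h3
    rw [h0] at h1 h2
    have h4 : B * y ≤ B * T := by have := hy.2; gcongr
    have h5 : |Q α y| ≤ B * T := by rw [abs_of_nonneg (by linarith)]; linarith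
    exact (abs_sub _ _).trans (add_le_add h5 h3)
  have hcont : Continuous fun α => Q α T := by
    refine continuous_iff_continuousAt.2 fun α => tendsto_iff_dist_tendsto_zero.2 ?_
    have hlim : Filter.Tendsto (fun α' : Set.Icc (0 : ℝ) A =>
        gronwallBound 0 α (|(α' : ℝ) - α| * (B * T + F)) T) (nhds α) (nhds 0) := by
      have hc : Continuous fun α' : Set.Icc (0 : ℝ) A =>
          gronwallBound 0 α (|(α' : ℝ) - α| * (B * T + F)) T :=
        (gronwallBound_continuous_ε 0 α T).comp (by fun_prop)
      have := hc.tendsto α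
      rwa [sub_self, abs_zero, zero_mul, gronwallBound_ε0_δ0] at this
    refine squeeze_zero (fun _ => dist_nonneg) (fun α' => ?_) hlim
    rw [dist_comm]
    exact dist_curve_le hφ α.2.1 hT0 (hd α) (hd α') (h0 α) (h0 α') (hq α) (hq α') (hC α')
  have hZ : Continuous fun α : Set.Icc (0 : ℝ) A => (α : ℝ) * (Q α T - S.ext T) := by fun_prop
  have : PreconnectedSpace (Set.Icc (0 : ℝ) A) :=
    isPreconnected_iff_preconnectedSpace.1 isPreconnected_Icc
  obtain ⟨α, hα⟩ := mem_range_of_exists_le_of_exists_ge hZ (c := θ)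
    ⟨⟨0, le_rfl, hA0.le⟩, by simpa using hθ.le⟩
    ⟨⟨A, hA0.le, le_rfl⟩, S.le_mul_of_curve (by linarith) (by linarith)
      (le_add_of_nonneg_left hθ.le) (le_add_of_nonneg_right hA2) (hd _) (h0 _) (hq _)⟩
  have hα' : (α : ℝ) * (Q α T - S.ext T) = θ := hα
  have hαpos : (0 : ℝ) < α := lt_of_le_of_ne α.2.1 fun h => by
    rw [← h, zero_mul] at hα'
    linarith
  refine ⟨α, Q α, q α, hαpos, hd α, h0 α, fun y hy => ?_, hα'⟩
  rw [hq α y hy]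
  refine min_eq_left (le_trans (S.priceOf_mono ?_) (by simp only [B]; linarith :
    S.priceOf (θ + A * S.ext T) ≤ B))
  have h1 := mul_sub_le_sub_of_le_deriv (hd α) hy.2 (m := 0) fun z hz => by
    rw [hq α z ⟨hy.1.trans hz.1, hz.2⟩]; exact hφ0 _
  have h2 := S.ext_nonneg y
  calc (α : ℝ) * (Q α y - S.ext y) ≤ α * Q α T := by gcongr; linarith
    _ = θ + α * S.ext T := by linarith
    _ ≤ θ + A * S.ext T := by have := α.2.2; gcongr

/-- The first time a curve reaches a value below its final one; it stays above it afterwards. -/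
theorem exists_first_time {α : ℝ} {Q q : ℝ → ℝ} (hα : 0 < α) (hd : ∀ y, HasDerivAt Q (q y) y)
    (h0 : Q 0 = 0)
    (hq : ∀ y ∈ Set.Icc 0 (S.kHigh : ℝ), q y = S.priceOf (α * (Q y - S.ext y))) {θ : ℝ}
    (hθ : 0 < θ) (hθT : θ ≤ α * (Q S.kHigh - S.ext S.kHigh)) :
    ∃ x : ℝ, 0 < x ∧ x ≤ S.kHigh ∧ α * (Q x - S.ext x) = θ ∧
      (∀ y ∈ Set.Ico 0 x, α * (Q y - S.ext y) < θ) ∧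
      ∀ y ∈ Set.Icc x (S.kHigh : ℝ), θ ≤ α * (Q y - S.ext y) := by
  have hQc : Continuous Q := continuous_iff_continuousAt.2 fun y => (hd y).continuousAt
  have hzc : Continuous fun y => α * (Q y - S.ext y) :=
    continuous_const.mul (hQc.sub S.continuous_ext)
  set X := Set.Icc 0 (S.kHigh : ℝ) ∩ {y | θ ≤ α * (Q y - S.ext y)}
  have hXc : IsCompact X := isCompact_Icc.inter_right (isClosed_le continuous_const hzc)
  have hXne : X.Nonempty := ⟨S.kHigh, ⟨Nat.cast_nonneg _, le_rfl⟩, hθT⟩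
  obtain ⟨x, ⟨hx, hxθ⟩, hmin⟩ := hXc.exists_isLeast hXne
  have hbefore : ∀ y ∈ Set.Ico 0 x, α * (Q y - S.ext y) < θ := fun y hy => by
    by_contra! h
    exact absurd (hmin ⟨⟨hy.1, hy.2.le.trans hx.2⟩, h⟩) (not_le.2 hy.2)
  have hx0 : 0 < x := lt_of_le_of_ne hx.1 (by
    rintro rfl
    simp only [Set.mem_ofPred_eq, h0, S.ext_zero, sub_self, mul_zero] at hxθ
    linarith)
  have hxle : α * (Q x - S.ext x) ≤ θ := by
    obtain ⟨y, hy, hyθ⟩ := intermediate_value_Icc hx.1 hzc.continuousOn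
      (show θ ∈ Set.Icc _ _ from ⟨by simp only [h0, S.ext_zero, sub_self, mul_zero]; exact hθ.le,
        hxθ⟩)
    rcases hy.2.eq_or_lt with rfl | hlt
    · exact hyθ.le
    · exact absurd hyθ (hbefore y ⟨hy.1, hlt⟩).ne
  refine ⟨x, hx0, hx.2, le_antisymm hxle hxθ, hbefore, fun y hy => ?_⟩
  have hsub : Set.Icc x (S.kHigh : ℝ) ⊆ Set.Icc 0 (S.kHigh : ℝ) := Set.Icc_subset_Icc_left hx.1
  have hk : (S.kHigh : ℝ) ≤ S.k := by exact_mod_cast S.kHigh_le_k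
  have := min_le_of_slope_monotone hd
    (S.convexOn_ext.subset (hsub.trans (Set.Icc_subset_Icc_right hk)) (convex_Icc _ _))
    S.continuous_ext.continuousOn (fun s hs t ht hst => by
      rw [hq s (hsub hs), hq t (hsub ht)]
      exact S.priceOf_mono (by gcongr)) hy
  rcases min_le_iff.1 this with h | h
  · exact hxθ.trans (by gcongr)
  · exact hθT.trans (by gcongr)

/-- A curve whose slope is the affine function of the profit belonging to `K` units follows
`price`. -/
theorem price_eq_of_curve {α K C : ℝ} (hK : 0 < K) {Q q : ℝ → ℝ}
    (hd : ∀ y, HasDerivAt Q (q y) y) {a b l : ℝ} (hab : a ≤ b)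
    (hq : ∀ y ∈ Set.Icc a b, K * q y = α * (Q y - S.ext y) + C) (hl : q a = l) :
    S.price α K a l b = q b := by
  -- `D` equals `K` times the difference of the two prices on `[a, b]`; it vanishes at `a` and
  -- satisfies `D' = (α / K) * D`, so it vanishes throughout.
  set D : ℝ → ℝ := fun y => (K * S.price α K a l y + α * S.ext y) - α * Q y - C
  have hD : ∀ y, HasDerivAt D (α * S.price α K a l y - α * q y) y := fun y =>
    ((S.hasDerivAt_price α hK a l y).sub ((hd y).const_mul α)).sub_const C
  have hE : ∀ y, HasDerivAt (fun y => D y * Real.exp (-(α / K * y)))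
      ((α * S.price α K a l y - α * q y) * Real.exp (-(α / K * y))
        + D y * (Real.exp (-(α / K * y)) * -(α / K * 1))) y := fun y =>
    (hD y).mul (((hasDerivAt_id y).const_mul _).neg.exp)
  have hDq : ∀ y ∈ Set.Icc a b, D y = K * (S.price α K a l y - q y) := fun y hy => by
    have := hq y hy
    simp only [D]
    linarith
  have hconst := constant_of_has_deriv_right_zero (a := a) (b := b)
    (fun y _ => (hE y).continuousAt.continuousWithinAt)
    (fun y hy => by
      have := (hE y).hasDerivWithinAt (s := Set.Ici y)
      rw [hDq y ⟨hy.1, hy.2.le⟩] at this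
      convert! this using 1
      field_simp
      ring) b ⟨hab, le_rfl⟩
  rw [hDq a ⟨le_rfl, hab⟩, S.price_self α hK, hl, sub_self, mul_zero, zero_mul, mul_eq_zero,
    or_iff_left (Real.exp_pos _).ne', hDq b ⟨hab, le_rfl⟩, mul_eq_zero, or_iff_right hK.ne',
    sub_eq_zero] at hconst
  exact hconst

theorem threshold_mono {i j : ℕ} (hij : i ≤ j) (hj : j ≤ S.gap) :
    S.threshold i ≤ S.threshold j := by
  induction j, hij using Nat.le_induction with
  | base => exact le_rfl
  | succ j _ ih =>
    refine (ih (by omega)).trans ?_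
    rw [← S.threshold_succ hj]
    have := S.level_le_succ (i := j) (by omega)
    have := S.kLow_add_pos j
    unfold threshold
    gcongr

theorem threshold_gap_le : S.threshold S.gap ≤ S.best S.pmax := by
  have h := S.level_le_succ (i := S.gap) le_rfl
  have hg : (S.kLow : ℝ) + S.gap = S.kHigh := by exact_mod_cast S.kLow_add_gap
  rw [level_last] at h
  rw [best_pmax]
  unfold threshold
  rw [hg]
  gcongr

/-- Breakpoints are first hitting times of the thresholds. After a hitting time the profit stays
above its threshold by quasi-concavity, and before the next one it stays below the next, so on each
piece `priceOf` is a single affine branch. -/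
theorem exists_isKnots : ∃ α g, S.IsKnots α g := by
  obtain ⟨α, Q, q, hα, hd, h0, hq, hend⟩ := S.exists_rate
  have hθ : ∀ i ≤ S.gap, 0 < S.threshold i := fun i hi =>
    (S.threshold_zero ▸ S.surplus_kLow_pos).trans_le (S.threshold_mono (Nat.zero_le i) hi)
  have hθT : ∀ i ≤ S.gap, S.threshold i ≤ α * (Q S.kHigh - S.ext S.kHigh) := fun i hi =>
    hend ▸ (S.threshold_mono hi le_rfl).trans S.threshold_gap_le
  have hex : ∀ i, ∃ x : ℝ, i ≤ S.gap → 0 < x ∧ x ≤ S.kHigh ∧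
      α * (Q x - S.ext x) = S.threshold i ∧
      (∀ y ∈ Set.Ico 0 x, α * (Q y - S.ext y) < S.threshold i) ∧
      ∀ y ∈ Set.Icc x (S.kHigh : ℝ), S.threshold i ≤ α * (Q y - S.ext y) := fun i => by
    by_cases hi : i ≤ S.gap
    · obtain ⟨x, hx⟩ := S.exists_first_time hα hd h0 hq (hθ i hi) (hθT i hi)
      exact ⟨x, fun _ => hx⟩
    · exact ⟨0, fun h => absurd h hi⟩
  choose x hx using hex
  -- The last breakpoint is `kHigh` by decree; the end condition of the curve makes its price
  -- `pmax`.
  set g : ℕ → ℝ := fun i => if i ≤ S.gap then x i else S.kHigh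
  have hgx : ∀ i ≤ S.gap, g i = x i := fun i hi => if_pos hi
  have hgl : g (S.gap + 1) = S.kHigh := if_neg (by omega)
  have hle : ∀ i ≤ S.gap, g i ≤ g (i + 1) := fun i hi => by
    rcases hi.eq_or_lt with rfl | hi'
    · rw [hgl, hgx _ le_rfl]
      exact (hx _ le_rfl).2.1
    · rw [hgx i hi, hgx (i + 1) hi']
      by_contra! hlt
      have h1 := (hx i hi).2.2.2.1 _ ⟨(hx (i + 1) hi').1.le, hlt⟩
      rw [(hx (i + 1) hi').2.2.1] at h1
      exact absurd h1 (not_lt.2 (S.threshold_mono (Nat.le_succ i) hi'))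
  have hgk : ∀ i ≤ S.gap + 1, g i ≤ S.kHigh := fun i hi => by
    rcases Nat.lt_or_ge S.gap i with h | h
    · exact (if_neg (by omega) : g i = S.kHigh).le
    · rw [hgx i h]; exact (hx i h).2.1
  have hpiece : ∀ i ≤ S.gap, ∀ y ∈ Set.Icc (g i) (g (i + 1)),
      (S.kLow + i) * q y = α * (Q y - S.ext y) + S.cost (S.kLow + i) := fun i hi y hy => by
    have hxi := hx i hi
    have hyk : y ≤ S.kHigh := hy.2.trans (hgk _ (by omega))
    rw [hgx i hi] at hy
    rw [hq y ⟨hxi.1.le.trans hy.1, hyk⟩, S.priceOf_eq hi (hxi.2.2.2.2 y ⟨hy.1, hyk⟩) fun hi' => ?_,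
      mul_div_cancel₀ _ (S.kLow_add_pos i).ne']
    have hxs := hx (i + 1) hi'
    have hy2 := hy.2
    rw [hgx _ hi'] at hy2
    rcases hy2.eq_or_lt with rfl | hlt
    · exact hxs.2.2.1.le
    · exact (hxs.2.2.2.1 y ⟨hxi.1.le.trans hy.1, hlt⟩).le
  refine ⟨α, g, hα, ?_, hle, hgl, ?_, fun i hi => ?_⟩
  · rw [hgx 0 (Nat.zero_le _)]
    exact (hx 0 (Nat.zero_le _)).1
  · obtain ⟨hx0, hxk, hxe, hxb, -⟩ := hx 0 (Nat.zero_le _)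
    have hQ : Q (x 0) - S.pmin * x 0 = Q 0 - S.pmin * 0 :=
      constant_of_has_deriv_right_zero (f := fun y => Q y - S.pmin * y) (a := 0) (b := x 0)
        (fun y _ => ((hd y).sub ((hasDerivAt_id y).const_mul
          S.pmin)).continuousAt.continuousWithinAt)
        (fun y hy => by
          have := ((hd y).sub ((hasDerivAt_id y).const_mul
            S.pmin)).hasDerivWithinAt (s := Set.Ici y)
          rwa [hq y ⟨hy.1, hy.2.le.trans hxk⟩, S.priceOf_eq_pmin (hxb y hy).le, mul_one,
            sub_self] at this)
        (x 0) ⟨hx0.le, le_rfl⟩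
    have hk : (S.kHigh : ℝ) ≤ S.k := by exact_mod_cast S.kHigh_le_k
    rw [hgx 0 (Nat.zero_le _), ← hxe, S.ext_eq ⟨hx0.le, hxk.trans hk⟩]
    rw [h0] at hQ
    congr 2
    linarith
  · have hK := S.kLow_add_pos i
    have hqa : q (g i) = S.level i := by
      have h1 := hpiece i hi (g i) ⟨le_rfl, hle i hi⟩
      rw [hgx i hi, (hx i hi).2.2.1] at h1
      unfold threshold at h1
      rw [hgx i hi]
      exact mul_left_cancel₀ hK.ne' (by linarith)
    rw [S.price_eq_of_curve hK hd (hle i hi) (hpiece i hi) hqa]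
    refine mul_left_cancel₀ hK.ne' ?_
    rw [hpiece i hi _ ⟨hle i hi, le_rfl⟩]
    rcases hi.eq_or_lt with rfl | hi'
    · have hg : (S.kLow : ℝ) + S.gap = S.kHigh := by exact_mod_cast S.kLow_add_gap
      rw [hgl, hend, best_pmax, level_last, hg]
      ring
    · rw [hgx _ hi', (hx (i + 1) hi').2.2.1, ← S.threshold_succ hi']
      ring

end Setup

end OSCC

end

theorem theorem2 (S : OSCC.Setup) :
    (∃ γ, S.IsSolution γ) ∧
    (S.level S.gap < S.pmax → ∀ γ γ', S.IsSolution γ → S.IsSolution γ' → γ = γ') ∧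
    (∀ γ, S.IsSolution γ →
      (∀ i : Fin (S.gap + 1), S.level i < S.level (i + 1) → γ i.castSucc < γ i.succ) ∧
      (1 ≤ S.ratio (γ 0) → γ 0 ≤ S.kLow) ∧
      (∀ ε : ℝ, 0 < ε →
        ∀ (Ω : Type*) [MeasurableSpace Ω] (μ : MeasureTheory.Measure Ω)
          [MeasureTheory.IsProbabilityMeasure μ] (A : S.Algorithm Ω),
          ¬ S.IsCompetitive A μ (S.ratio (γ 0) - ε))) := by
  refine ⟨?_, fun hlt γ γ' h h' => ?_, fun γ h => ⟨fun i hi => ?_, fun h1 => ?_, ?_⟩⟩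
  · obtain ⟨α, g, h⟩ := S.exists_isKnots
    exact ⟨_, h.isSolution⟩
  · ext i
    rw [← OSCC.Setup.knot_val γ, ← OSCC.Setup.knot_val γ']
    exact h.isKnots.unique hlt h'.isKnots (by omega)
  · refine lt_of_le_of_ne (h.mono (Fin.castSucc_lt_succ).le) fun he => ?_
    have hk := h.isKnots.price_eq i (by omega)
    have he' : OSCC.Setup.knot γ i = OSCC.Setup.knot γ (i + 1) := by
      have h1 := OSCC.Setup.knot_val γ i.castSucc
      have h2 := OSCC.Setup.knot_val γ i.succ
      rw [Fin.val_castSucc] at h1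
      rw [Fin.val_succ] at h2
      rw [h1, h2, he]
    -- On a piece of length zero the price does not move, so the two levels would coincide.
    rw [← he', S.price_self _ (S.kLow_add_pos i)] at hk
    exact hi.ne hk
  · have := h.isKnots.le_kLow h1
    rwa [OSCC.Setup.knot_zero] at this
  · intro ε hε Ω _ μ _ A
    exact h.isKnots.not_isCompetitive A (by linarith)
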